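/- Let $q=2^h$ with $h,k\ge 2$. Let $H_\infty$ be a hyperplane of $\mathrm{PG}(2k,q)$ and let $\mathcal S$ be a Desarguesian $(k-1)$-spread of $H_\infty\cong\mathrm{PG}(2k-1,q)$, that is, the set of $(k-1)$-spaces that arise from the points of $\mathrm{PG}(1,q^k)$, viewed as $k$-dimensional $\mathbb F_q$-subspaces of $\mathbb F_{q^k}^2$, under an $\mathbb F_q$-linear identification of $\mathbb F_{q^k}^2$ with the vector space underlying $H_\infty$. The André/Bruck–Bose plane $\mathcal P(\mathcal S)\cong\mathrm{PG}(2,q^k)$ has as points the points of $\mathrm{PG}(2k,q)$ outside $H_\infty$ (the affine points) and the elements of $\mathcal S$, and as lines the $k$-spaces spanned by an affine point and an element of $\mathcal S$, together with $H_\infty$. A hyperoval of $\mathrm{PG}(2,q^k)$ is a set of $q^k+2$ points, no three of which are collinear. It is a translation hyperoval with translation line $\ell$ if $\ell$ meets it in exactly two points and the group of elations with axis $\ell$ that stabilise it acts transitively on its points not on $\ell$. Let $\mathcal H$ be a translation hyperoval of $\mathrm{PG}(2,q^k)$ with translation line $\ell_\infty$, let $\mathrm{PG}(2,q^k)$ be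 identified with $\mathcal P(\mathcal S)$ by any isomorphism under which $\ell_\infty$ corresponds to $H_\infty$, and let $\mathcal Q$ be the set of affine points of $\mathrm{PG}(2k,q)$ that correspond to the points of $\mathcal H$ not on $\ell_\infty$. Let $D\subseteq H_\infty$ be the set of directions determined by $\mathcal Q$, i.e. the set of points in which the lines joining two distinct points of $\mathcal Q$ meet $H_\infty$. Then: 1. $|\mathcal Q|=q^k$. 2. $D$ is an $\mathbb F_2$-linear set of pseudoregulus type in $H_\infty$. This means that $D$ is the set of points $\langle u\rangle_{\mathbb F_q}$, $u\in U\setminus\{0\}$, for an $\mathbb F_2$-subspace $U$ of dimension $hk$ of the vector space underlying $H_\infty$, such that $U$ meets each point (one-dimensional $\mathbb F_q$-subspace) in an $\mathbb F_2$-subspace of dimension at most one, and that there exist $m=\frac{q^k-1}{q-1}$ pairwise disjoint lines $s_1,\dots,s_m$ of $H_\infty$ with $|D\cap s_i|=q-1$ for all $i$, for which there are exactly two $(k-1)$-dimensional projective subspaces of $H_\infty$ that are disjoint from $D$ and meet every $s_i$. 3. There are an integer $i\ge 0$ with $\gcd(i,hk)=1$ and an $\mathbb F_q$-linear identification of the vector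 space underlying $\mathrm{PG}(2k,q)$ with $\mathbb F_q\oplus\mathbb F_{q^k}\oplus\mathbb F_{q^k}$ under which $H_\infty$ has equation $X_0=0$, the elements of $\mathcal S$ are the subspaces $\{(0,ca,cb): c\in\mathbb F_{q^k}\}$ with $(a,b)\in\mathbb F_{q^k}^2\setminus\{(0,0)\}$, and $$\mathcal Q=\{(1,t,t^{2^i})_q : t\in\mathbb F_{q^k}\},\qquad D=\{(0,u,u^{2^i})_q : u\in\mathbb F_{q^k}^*\}.$$ Here $(\cdot,\cdot,\cdot)_q$ denotes the point of $\mathrm{PG}(2k,q)$ spanned over $\mathbb F_q$ by the given vector. -/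

import Mathlib

open scoped LinearAlgebra.Projectivization

/-! ### Planes given by a point type and a set of lines (sets of points) -/

section Planes

variable {P P' : Type*}

/-- `φ` is an isomorphism between the point-line geometries with line sets `L` and `L'`: it maps
the lines exactly onto the lines. -/
def IsPlaneIso (L : Set (Set P)) (L' : Set (Set P')) (φ : P ≃ P') : Prop :=
  ∀ m : Set P, m ∈ L ↔ φ '' m ∈ L'

/-- `σ` is an elation with axis `a`: a collineation that fixes every point of `a` and for which
there is a point `C` on `a` (a centre) such that every line through `C` is fixed. The identity is
counted as an elation. -/
def IsElation (L : Set (Set P)) (a : Set P) (σ : P ≃ P) : Prop :=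
  IsPlaneIso L L σ ∧ (∀ x ∈ a, σ x = x) ∧ ∃ C ∈ a, ∀ m ∈ L, C ∈ m → σ '' m = m

/-- A set of points no three of which are collinear. -/
def IsArc (L : Set (Set P)) (H : Set P) : Prop :=
  ∀ x ∈ H, ∀ y ∈ H, ∀ z ∈ H, x ≠ y → x ≠ z → y ≠ z → ∀ m ∈ L, ¬ (x ∈ m ∧ y ∈ m ∧ z ∈ m)

/-- A hyperoval in a projective plane of order `N`: an arc with `N + 2` points. -/
def IsHyperoval (L : Set (Set P)) (N : ℕ) (H : Set P) : Prop :=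
  IsArc L H ∧ H.ncard = N + 2

/-- `H` is a translation hyperoval with translation line `a`: `H` is a hyperoval, `a` is a bisecant
of `H`, and the group of elations with axis `a` that stabilise `H` acts transitively on the points
of `H` that are not on `a`. -/
def IsTranslationHyperoval (L : Set (Set P)) (N : ℕ) (a : Set P) (H : Set P) : Prop :=
  IsHyperoval L N H ∧ a ∈ L ∧ (H ∩ a).ncard = 2 ∧
    ∀ x ∈ H \ a, ∀ y ∈ H \ a, ∃ σ : P ≃ P, IsElation L a σ ∧ σ '' H = H ∧ σ x = y

end Planes

/-! ### Projective spaces and linear sets -/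

section Linear

variable {F : Type*} [Field F] {W : Type*} [AddCommGroup W] [Module F W]

/-- The set of points of the projective space of `W` lying in the subspace given by `M`. -/
def projPoints (M : Submodule F W) : Set (ℙ F W) := {x | x.submodule ≤ M}

variable (F W) in
/-- The lines of the projective space of `W`, as sets of points. -/
def projLines : Set (Set (ℙ F W)) :=
  {m | ∃ M : Submodule F W, Module.finrank F M = 2 ∧ m = projPoints M}

/-- The set `L_U` of points spanned over `F` by the non-zero vectors of `U`, where `U` is a subspace
over a subfield `F₀` of `F`. -/
def linearSet {F₀ : Subfield F} (U : Submodule F₀ W) : Set (ℙ F W) :=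
  {x | ∃ u ∈ U, ∃ hu : u ≠ 0, x = Projectivization.mk F u hu}

/-- `U` is scattered: any two non-zero vectors of `U` spanning the same point over `F` span the same
point over `F₀`. -/
def IsScattered {F₀ : Subfield F} (U : Submodule F₀ W) : Prop :=
  ∀ u ∈ U, ∀ v ∈ U, u ≠ 0 → v ≠ 0 → (∃ c : F, v = c • u) → ∃ c : F₀, v = c • u

/-- `S` is a scattered `F₀`-linear set of rank `t`. -/
def IsScatteredLinearSet (F₀ : Subfield F) (t : ℕ) (S : Set (ℙ F W)) : Prop :=
  ∃ U : Submodule F₀ W, Module.finrank F₀ U = t ∧ IsScattered U ∧ S = linearSet U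

/-- With `q = |F₀|` and `F = F_{q^n}`: `S` is a scattered `F₀`-linear set of rank `kn` of
`PG(W) = PG(2k-1, q^n)` (where `n, k ≥ 2`) which is of pseudoregulus type, i.e.
there are `m = (q^{nk}-1)/(q^n-1)` pairwise disjoint lines `s i`, each meeting `S` in
`(q^n-1)/(q-1)` points, such that exactly two `(k-1)`-dimensional projective subspaces are disjoint
from `S` and meet every line `s i`. -/
def IsPseudoregulusType (F₀ : Subfield F) (k n : ℕ) (S : Set (ℙ F W)) : Prop :=
  2 ≤ n ∧ 2 ≤ k ∧ Module.finrank F₀ F = n ∧ Module.finrank F W = 2 * k ∧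
  IsScatteredLinearSet F₀ (k * n) S ∧
  ∃ s : Fin ((Nat.card F₀ ^ (n * k) - 1) / (Nat.card F₀ ^ n - 1)) → Submodule F W,
    (∀ i, Module.finrank F (s i) = 2) ∧
    (∀ i j, i ≠ j → Disjoint (projPoints (s i)) (projPoints (s j))) ∧
    (∀ i, (S ∩ projPoints (s i)).ncard = (Nat.card F₀ ^ n - 1) / (Nat.card F₀ - 1)) ∧
    {T : Submodule F W | Module.finrank F T = k ∧ Disjoint (projPoints T) S ∧
      ∀ i, (projPoints T ∩ projPoints (s i)).Nonempty}.ncard = 2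

/-- The directions determined by a set `Q` of points outside the hyperplane `Hinf`: the points in
which the lines joining two distinct points of `Q` meet `Hinf`. They are points of the projective
space of `Hinf`. -/
def directions (Hinf : Submodule F W) (Q : Set (ℙ F W)) : Set (ℙ F Hinf) :=
  {d | ∃ x ∈ Q, ∃ y ∈ Q, x ≠ y ∧ d.submodule.map Hinf.subtype ≤ x.submodule ⊔ y.submodule}

end Linear

/-! ### The André/Bruck-Bose construction -/

section BruckBose

variable {F : Type*} [Field F] {V : Type*} [AddCommGroup V] [Module F V]

/-- `S` is a Desarguesian spread of the projective space of the subspace `Hinf` of `V`, coming from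
the projective line over the extension field `K` of `F`: for some `F`-linear identification `e` of
`K²` with `Hinf`, the elements of `S` are the images of the points of `PG(1, K)`, viewed as
`F`-subspaces of `K²`. -/
def IsDesarguesianSpread (K : Type*) [Field K] [Algebra F K]
    (Hinf : Submodule F V) (S : Set (Submodule F V)) : Prop :=
  ∃ e : (Fin 2 → K) ≃ₗ[F] Hinf,
    S = {T | ∃ p : ℙ K (Fin 2 → K),
      T = ((p.submodule.restrictScalars F).map e.toLinearMap).map Hinf.subtype}

/-- The points of the André/Bruck-Bose plane: the affine points (the points of the projective
space of `V` not in `Hinf`) together with the elements of the spread `S`. -/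
abbrev ABBPoint (Hinf : Submodule F V) (S : Set (Submodule F V)) : Type _ :=
  {x : ℙ F V // ¬ x.submodule ≤ Hinf} ⊕ S

/-- The subspace of the projective space of `V` underlying a point of the plane. -/
def ABBPoint.toSubmodule {Hinf : Submodule F V} {S : Set (Submodule F V)} :
    ABBPoint Hinf S → Submodule F V :=
  Sum.elim (fun x => x.1.submodule) (fun T => T.1)

/-- The lines of the André/Bruck-Bose plane: the subspaces spanned by an affine point and an
element of the spread, and `Hinf` itself; incidence is containment. -/
def ABBLines (Hinf : Submodule F V) (S : Set (Submodule F V)) : Set (Set (ABBPoint Hinf S)) :=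
  {m | ∃ M : Submodule F V,
    (M = Hinf ∨ ∃ x : ℙ F V, ¬ x.submodule ≤ Hinf ∧ ∃ T ∈ S, M = x.submodule ⊔ T) ∧
    m = {y | y.toSubmodule ≤ M}}

/-- The affine points among the members of a set `A` of points of the André/Bruck-Bose plane, as
points of the projective space of `V`. -/
def ABBAffinePart {Hinf : Submodule F V} {S : Set (Submodule F V)}
    (A : Set (ABBPoint Hinf S)) : Set (ℙ F V) :=
  {x | ∃ hx : ¬ x.submodule ≤ Hinf, (Sum.inl ⟨x, hx⟩ : ABBPoint Hinf S) ∈ A}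

end BruckBose

/-! ### Translation o-polynomials -/

section Payne

open Finset Polynomial

/-! Since the spread is Desarguesian, the affine points `⟨w₀ + e z⟩` are parametrised by `z` in
`K²`, and the lines of the plane are the `K`-affine lines (`isAffineChart_ABB`). An elation with
axis at infinity is a translation (`exists_translation`), so a translation hyperoval through the
origin has an additively closed affine part. In the basis given by its two points at infinity this
part is the graph of an additive map `f`. As no three points are collinear, `x ↦ f x / x` is
injective on `Kˣ`, hence onto.

Payne's theorem (`exists_eq_mul_pow_two_pow`) then gives `f x = c * x ^ 2 ^ i` with `i` coprime to
`n`, where `|K| = 2 ^ n`. Write `f` as a linearized polynomial with Dickson matrix `A`. For each `c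
≠ 0` the equation `f x = c * x` has a non-zero solution, so `A + diag (c ^ 2 ^ j)` is singular. Its
determinant is a polynomial in `c` whose coefficients are the principal minors of `A`, and its
vanishing on `Kˣ` kills all proper ones. Then the digraph of `A` has no closed walk shorter than `n`
(`not_hasClosedWalk`). This digraph is circulant on `ZMod n`, so exactly one coefficient of `f`
survives, and its index generates `ZMod n`.

After `c` is absorbed into the coordinates, the affine points are the `(1, t, t ^ 2 ^ i)`.
Differences of such vectors have the same shape, which gives the directions `(0, u, u ^ 2 ^ i)`. The
lines spanned by `(u, 0)` and `(0, u ^ 2 ^ i)` form the pseudoregulus, with transversal spaces `K ×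
0` and `0 × K` (`transversal_iff`). -/

/-- The principal minor of `A` on the complement of `T`. -/
noncomputable def principalMinorCompl {R α : Type*} [CommRing R] [Fintype α] [DecidableEq α]
    (A : Matrix α α R) (T : Finset α) : R :=
  ∑ σ : Equiv.Perm α with ∀ j ∈ T, σ j = j,
    ((Equiv.Perm.sign σ : ℤ) : R) * ∏ j ∈ Tᶜ, A (σ j) j

/-- In the Leibniz expansion, `T` records the columns whose entry comes from the diagonal matrix.
Such a term is zero unless the permutation fixes every element of `T`. -/
theorem det_add_diagonal_eq_sum {R α : Type*} [CommRing R] [Fintype α] [DecidableEq α]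
    (A : Matrix α α R) (d : α → R) :
    (A + Matrix.diagonal d).det = ∑ T : Finset α, principalMinorCompl A T * ∏ j ∈ T, d j := by
  have key : ∀ σ : Equiv.Perm α, ∏ j, (A + Matrix.diagonal d) (σ j) j
      = ∑ T : Finset α, if (∀ j ∈ T, σ j = j) then (∏ j ∈ Tᶜ, A (σ j) j) * ∏ j ∈ T, d j
        else 0 := by
    intro σ
    simp only [Matrix.add_apply]
    simp_rw [add_comm (A _ _)]
    rw [Finset.prod_add, Finset.powerset_univ]
    refine Finset.sum_congr rfl fun T _ => ?_
    rw [← Finset.compl_eq_univ_sdiff]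
    split_ifs with hT
    · rw [mul_comm]
      congr 1
      refine Finset.prod_congr rfl fun j hj => ?_
      rw [hT j hj, Matrix.diagonal_apply_eq]
    · push Not at hT
      obtain ⟨j, hj, hne⟩ := hT
      exact mul_eq_zero_of_left (Finset.prod_eq_zero (f := fun i => Matrix.diagonal d (σ i) i) hj
        (Matrix.diagonal_apply_ne d hne)) _
  rw [Matrix.det_apply']
  simp_rw [key, Finset.mul_sum]
  rw [Finset.sum_comm]
  refine Finset.sum_congr rfl fun T _ => ?_
  rw [principalMinorCompl, Finset.sum_filter, Finset.sum_mul]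
  refine Finset.sum_congr rfl fun σ _ => ?_
  split_ifs <;> ring

/-- A polynomial of degree at most `|K| - 1` vanishing on `Kˣ` is a multiple of `X ^ (|K| - 1) - 1`,
so its intermediate coefficients vanish. -/
theorem coeff_eq_zero_of_eval_eq_zero {K : Type*} [Field K] [Fintype K] (P : K[X]) (N : ℕ)
    (hN : Fintype.card K = N + 1) (hP : P.natDegree ≤ N) (h0 : ∀ x : K, x ≠ 0 → P.eval x = 0)
    (m : ℕ) (hm0 : 0 < m) (hmN : m < N) : P.coeff m = 0 := by
  classical
  set R := P - C (P.coeff N) * (X ^ N - 1) with hR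
  have hpow : ∀ x : K, x ≠ 0 → x ^ N = 1 := by
    intro x hx
    have := FiniteField.pow_card_sub_one_eq_one x hx
    rwa [hN, Nat.add_sub_cancel] at this
  have hN0 : 0 < N := by omega
  have hcoeff : ∀ j, R.coeff j = P.coeff j - P.coeff N * ((if j = N then 1 else 0) -
      if j = 0 then 1 else 0) := by
    intro j
    rw [hR, coeff_sub, coeff_C_mul, coeff_sub, coeff_X_pow, coeff_one]
  have hdeg : R.natDegree < N := by
    rw [Nat.lt_iff_le_pred hN0, natDegree_le_iff_coeff_eq_zero]
    intro j hj
    replace hj : N ≤ j := by omega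
    rw [hcoeff]
    rcases hj.eq_or_lt with rfl | hj
    · simp [hN0.ne']
    · rw [coeff_eq_zero_of_natDegree_lt (hP.trans_lt hj)]
      simp [hj.ne', (hN0.trans hj).ne']
  have hRz : R = 0 := by
    refine Polynomial.eq_zero_of_natDegree_lt_card_of_eval_eq_zero' R (univ.erase 0) ?_ ?_
    · intro x hx
      have hx := Finset.ne_of_mem_erase hx
      simp [hR, h0 x hx, hpow x hx]
    · rw [Finset.card_erase_of_mem (mem_univ _), Finset.card_univ, hN]
      simpa using hdeg
  have := hcoeff m
  rw [hRz] at this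
  simpa [hmN.ne, hm0.ne'] using this.symm

/-! ### Closed walks in the digraph of a matrix -/

/-- `A` has a closed walk of length `r` in its digraph of non-zero entries. -/
def HasClosedWalk {R α : Type*} [Zero R] (A : Matrix α α R) (r : ℕ) : Prop :=
  ∃ p : ℕ → α, (∀ t, A (p (t + 1)) (p t) ≠ 0) ∧ ∀ t, p (t + r) = p t

theorem hasClosedWalk_of_walk {R α : Type*} [Zero R] {A : Matrix α α R} {r : ℕ} (hr : 0 < r)
    (q : ℕ → α) (hq : ∀ t < r, A (q (t + 1)) (q t) ≠ 0) (hqr : q r = q 0) :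
    HasClosedWalk A r := by
  refine ⟨fun t => q (t % r), fun t => ?_, fun t => by simp⟩
  have ht := Nat.mod_lt t hr
  have := hq _ ht
  rcases (Nat.succ_le_of_lt ht).eq_or_lt with h | h
  · have h1 : (t + 1) % r = 0 := by
      rw [← Nat.mod_add_mod, ← Nat.succ_eq_add_one, h, Nat.mod_self]
    have h2 : t % r + 1 = r := h
    simp only [h1]
    rwa [h2, hqr] at this
  · have h1 : (t + 1) % r = t % r + 1 := by
      rw [← Nat.mod_add_mod, Nat.mod_eq_of_lt h]
    simpa only [h1] using this

/-- A closed walk of minimal length repeats no vertex and has no chord. So in the principal minor on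
its vertices the only non-zero term is that of the cycle itself, and the minor cannot vanish. -/
theorem not_hasClosedWalk {K α : Type*} [Field K] [Fintype α] [DecidableEq α] (A : Matrix α α K)
    (hA : ∀ T : Finset α, T.Nonempty → T ≠ univ → principalMinorCompl A T = 0)
    (r : ℕ) (hr : 0 < r) (hrn : r < Fintype.card α) : ¬ HasClosedWalk A r := by
  induction r using Nat.strong_induction_on with
  | _ r ih =>
  rintro ⟨p, hp, hper⟩
  have hmod : ∀ t, p (t % r) = p t := by
    intro t
    conv_rhs => rw [← Nat.mod_add_div t r]
    generalize t / r = u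
    induction u with
    | zero => simp
    | succ u ihu => rw [Nat.mul_succ, ← add_assoc, hper, ihu]
  -- A step from `p a` back to `p b` would close up the stretch from `b` to `a` to a walk of length
  -- `a - b + 1`.
  have chord : ∀ a b, b ≤ a → a - b + 1 < r → A (p b) (p a) = 0 := by
    intro a b hba hlt
    by_contra hne
    refine ih (a - b + 1) hlt (by omega) (by omega) (hasClosedWalk_of_walk (by omega)
      (fun t => if t ≤ a - b then p (b + t) else p b) ?_ (by simp))
    intro t ht
    rcases (Nat.lt_succ_iff.mp ht).eq_or_lt with h | h
    · subst h
      have : b + (a - b) = a := by omega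
      simpa [this] using hne
    · have h1 : t + 1 ≤ a - b := h
      simp only [h1, h.le, if_true]
      exact hp (b + t)
  -- If `p a = p b`, the step out of `p a` is a chord from `p b` back to `p (a + 1)`.
  have inj : ∀ a b, a < b → b < r → p a ≠ p b := by
    intro a b hab hb h
    have := chord b (a + 1) (by omega) (by omega)
    rw [← h] at this
    exact hp a this
  -- A forward jump is a backward chord once `a` is replaced by `a + r`. What remains is `b = a +
  -- 1`, or `a = r - 1` with `b = 0`.
  have succ_of : ∀ a < r, ∀ b < r, A (p b) (p a) ≠ 0 → p b = p (a + 1) := by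
    intro a ha b hb hne
    rcases le_or_gt b a with h | h
    · have : ¬ a - b + 1 < r := fun hlt => hne (chord a b h hlt)
      have h1 : a + 1 = 0 + r := by omega
      have h2 : b = 0 := by omega
      rw [h1, hper, h2]
    · have : ¬ a + r - b + 1 < r := fun hlt => hne (by
        have := chord (a + r) b (by omega) hlt
        rwa [hper] at this)
      congr 1
      omega
  set l := (List.range r).map p with hl
  have hlen : l.length = r := by simp [hl]
  have hnd : l.Nodup := by
    refine List.Nodup.map_on ?_ List.nodup_range
    intro a ha b hb hab
    rw [List.mem_range] at ha hb
    rcases lt_trichotomy a b with h | h | h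
    · exact absurd hab (inj a b h hb)
    · exact h
    · exact absurd hab.symm (inj b a h ha)
  have hmem : ∀ x, x ∈ l ↔ ∃ a < r, p a = x := by
    intro x; simp [hl]
  have hσ : ∀ a < r, l.formPerm (p a) = p (a + 1) := by
    intro a ha
    have h1 := List.formPerm_apply_getElem l hnd a (by omega)
    simp only [hl, List.getElem_map, List.getElem_range, List.length_map, List.length_range] at h1
    rw [hl, h1, hmod]
  set T : Finset α := l.toFinsetᶜ with hT
  have hTc : ∀ x, x ∈ Tᶜ ↔ ∃ a < r, p a = x := by
    intro x; simp [hT, hmem]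
  have hTne : T.Nonempty := by
    rw [← Finset.card_pos, hT, Finset.card_compl, List.toFinset_card_of_nodup hnd]
    omega
  have hTu : T ≠ univ := by
    intro h
    have : p 0 ∈ Tᶜ := (hTc _).2 ⟨0, hr, rfl⟩
    simp [h] at this
  have hz := hA T hTne hTu
  rw [principalMinorCompl, Finset.sum_eq_single l.formPerm] at hz
  · rcases mul_eq_zero.1 hz with h | h
    · have := Int.units_eq_one_or (Equiv.Perm.sign l.formPerm)
      rcases this with h' | h' <;> simp [h'] at h
    · rw [Finset.prod_eq_zero_iff] at h
      obtain ⟨x, hx, hx0⟩ := h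
      obtain ⟨a, ha, rfl⟩ := (hTc x).1 hx
      rw [hσ a ha] at hx0
      exact hp a hx0
  -- A permutation with a non-zero term fixes `T`, hence preserves the vertices of the walk, and
  -- `succ_of` forces it to follow the cycle.
  · intro τ hτ hne
    rw [Finset.mem_filter] at hτ
    refine mul_eq_zero_of_right _ ?_
    by_contra hprod
    apply hne
    rw [← ne_eq, Finset.prod_ne_zero_iff] at hprod
    ext x
    by_cases hx : x ∈ Tᶜ
    · have hτx : τ x ∈ Tᶜ := by
        rw [Finset.mem_compl]
        intro h
        have h2 := hτ.2 _ h
        rw [τ.injective h2] at h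
        exact (Finset.mem_compl.1 hx) h
      have hx' := hprod x hx
      obtain ⟨a, ha, rfl⟩ := (hTc x).1 hx
      obtain ⟨b, hb, hb'⟩ := (hTc _).1 hτx
      rw [← hb'] at hx' ⊢
      rw [hσ a ha]
      exact succ_of a ha b hb hx'
    · have hxT : x ∈ T := by simpa using hx
      rw [hτ.2 x hxT, List.formPerm_apply_of_notMem]
      rw [hmem, ← hTc]
      exact hx
  · intro h
    exfalso
    apply h
    rw [Finset.mem_filter]
    refine ⟨mem_univ _, fun x hx => List.formPerm_apply_of_notMem ?_⟩
    rw [hmem, ← hTc]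
    simpa using hx

/-! ### Linearized polynomials and their Dickson matrices -/

theorem pow_two_pow_mod {K : Type*} [Field K] [Fintype K] {n : ℕ} (hn : Fintype.card K = 2 ^ n)
    (x : K) (m : ℕ) : x ^ 2 ^ (m % n) = x ^ 2 ^ m := by
  conv_rhs => rw [← Nat.mod_add_div m n, pow_add, pow_mul]
  rw [pow_mul 2 n, ← hn, FiniteField.pow_card_pow]

/-- Every additive map on a finite field of characteristic two is a linearized polynomial. -/
theorem exists_eq_sum_pow_two_pow {K : Type*} [Field K] [Fintype K] [CharP K 2] {n : ℕ} [NeZero n]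
    (hn : Fintype.card K = 2 ^ n) (f : K →+ K) :
    ∃ a : ZMod n → K, ∀ x, f x = ∑ i, a i * x ^ 2 ^ i.val := by
  classical
  let _ : Algebra (ZMod 2) K := ZMod.algebra K 2
  let fr : ZMod n → (K →ₗ[ZMod 2] K) := fun i =>
    (iterateFrobenius K 2 i.val).toAddMonoidHom.toZModLinearMap 2
  have hfr : ∀ i x, fr i x = x ^ 2 ^ i.val := fun i x => iterateFrobenius_def 2 i.val x
  -- A relation among the Frobenius powers is a polynomial of degree at most `2 ^ (n - 1)` with `2 ^
  -- n` roots. There are `n` of them in the `n`-dimensional `K`-space of additive maps, so they form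
  -- a basis.
  have hli : LinearIndependent K fr := by
    rw [Fintype.linearIndependent_iff]
    intro g hg
    let P : K[X] := ∑ i, C (g i) * X ^ 2 ^ i.val
    have hev : ∀ x, P.eval x = 0 := by
      intro x
      have := congrArg (fun φ : K →ₗ[ZMod 2] K => φ x) hg
      simpa [P, eval_finsetSum, hfr] using this
    have hP : P = 0 := by
      refine Polynomial.eq_zero_of_natDegree_lt_card_of_eval_eq_zero' P univ (fun x _ => hev x) ?_
      rw [Finset.card_univ, hn]
      refine lt_of_le_of_lt (natDegree_sum_le_of_forall_le (n := 2 ^ (n - 1)) _ _ fun i _ => ?_) ?_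
      · refine (natDegree_C_mul_X_pow_le _ _).trans ?_
        exact Nat.pow_le_pow_right (by norm_num) (Nat.le_sub_one_of_lt (ZMod.val_lt i))
      · exact Nat.pow_lt_pow_right (by norm_num) (Nat.sub_lt (NeZero.pos n) one_pos)
    intro i
    have hc : P.coeff (2 ^ i.val) = g i := by
      simp only [P, finsetSum_coeff, coeff_C_mul, coeff_X_pow]
      rw [Finset.sum_eq_single i]
      · simp
      · intro j _ hj
        rw [if_neg, mul_zero]
        intro h
        exact hj (ZMod.val_injective n (Nat.pow_right_injective le_rfl h)).symm
      · simp
    rw [← hc, hP, coeff_zero]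
  have hfin : Module.finrank (ZMod 2) K = n := by
    have := Module.card_eq_pow_finrank (K := ZMod 2) (V := K)
    rw [hn, ZMod.card] at this
    exact (Nat.pow_right_injective le_rfl this).symm
  have hspan := hli.span_eq_top_of_card_eq_finrank' (by
    rw [Module.finrank_linearMap_self, hfin, ZMod.card])
  have hmem : f.toZModLinearMap 2 ∈ Submodule.span K (Set.range fr) := by
    rw [hspan]; trivial
  obtain ⟨a, ha⟩ := (Submodule.mem_span_range_iff_exists_fun K).1 hmem
  refine ⟨a, fun x => ?_⟩
  have := congrArg (fun φ : K →ₗ[ZMod 2] K => φ x) ha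
  simpa [hfr] using this.symm

/-- If `x ↦ f x / x` is onto `Kˣ`, the proper principal minors of the Dickson matrix of the
linearized polynomial `f` vanish. -/
theorem principalMinorCompl_dickson_eq_zero {K : Type*} [Field K] [Fintype K] [CharP K 2] {n : ℕ}
    [NeZero n] (hn : Fintype.card K = 2 ^ n) (a : ZMod n → K)
    (ha : ∀ c : K, c ≠ 0 → ∃ x, x ≠ 0 ∧ ∑ i, a i * x ^ 2 ^ i.val = c * x)
    (T : Finset (ZMod n)) (hT : T.Nonempty) (hTu : T ≠ univ) :
    principalMinorCompl (Matrix.of fun j l : ZMod n => a (l - j) ^ 2 ^ j.val) T = 0 := by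
  classical
  set A : Matrix (ZMod n) (ZMod n) K := Matrix.of fun j l => a (l - j) ^ 2 ^ j.val with hA
  -- The vector of all `x ^ 2 ^ l` is in the kernel: row `j` is the equation `f x = c * x` raised to
  -- the power `2 ^ j`, and signs do not matter in characteristic two.
  have hdet : ∀ c : K, c ≠ 0 → (A + Matrix.diagonal fun j : ZMod n => c ^ 2 ^ j.val).det = 0 := by
    intro c hc
    obtain ⟨x, hx, hxc⟩ := ha c hc
    rw [← Matrix.exists_mulVec_eq_zero_iff]
    refine ⟨fun l => x ^ 2 ^ l.val, fun h => hx ?_, ?_⟩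
    · have := congrFun h 0
      simpa using this
    · ext j
      have h1 : (A.mulVec fun l => x ^ 2 ^ l.val) j = (c * x) ^ 2 ^ j.val := by
        rw [← hxc, sum_pow_char_pow]
        rw [Matrix.mulVec, dotProduct, ← Equiv.sum_comp (Equiv.addRight j)]
        refine Finset.sum_congr rfl fun i _ => ?_
        simp only [hA, Matrix.of_apply, Equiv.coe_addRight, add_sub_cancel_right, mul_pow]
        rw [ZMod.val_add, pow_two_pow_mod hn, ← pow_mul, pow_add]
      rw [Matrix.add_mulVec, Pi.add_apply, h1, Matrix.mulVec_diagonal, mul_pow]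
      simp [CharTwo.add_self_eq_zero]
  -- Binary expansions are unique, so each minor is a separate coefficient of `P`; the extreme
  -- exponents `0` and `2 ^ n - 1` belong to `∅` and `univ`.
  let e : Finset (ZMod n) → ℕ := fun T => ∑ j ∈ T, 2 ^ j.val
  have he : ∀ T, e T = ∑ j ∈ T.map ⟨ZMod.val, ZMod.val_injective n⟩, 2 ^ j := by
    intro T; simp [e]
  have heinj : Function.Injective e := by
    intro T T' h
    rw [he, he] at h
    exact Finset.map_injective _ (Finset.geomSum_injective le_rfl h)
  have hmono : ∀ T T', T ⊆ T' → T ≠ T' → e T < e T' := by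
    intro T T' h hne
    exact lt_of_le_of_ne (Finset.sum_le_sum_of_subset h) fun h' => hne (heinj h')
  have heu : e univ = 2 ^ n - 1 := by
    rw [he]
    have : (univ : Finset (ZMod n)).map ⟨ZMod.val, ZMod.val_injective n⟩ = range n := by
      refine Finset.eq_of_subset_of_card_le ?_ ?_
      · intro x
        simp only [mem_map, mem_univ, true_and, Function.Embedding.coeFn_mk, mem_range]
        rintro ⟨i, rfl⟩
        exact ZMod.val_lt i
      · simp
    rw [this, Nat.geomSum_eq le_rfl]
    simp
  let P : K[X] := ∑ T, C (principalMinorCompl A T) * X ^ e T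
  have hP0 : ∀ c : K, c ≠ 0 → P.eval c = 0 := by
    intro c hc
    rw [← hdet c hc, det_add_diagonal_eq_sum]
    simp [P, eval_finsetSum, e, Finset.prod_pow_eq_pow_sum]
  have hPd : P.natDegree ≤ 2 ^ n - 1 := by
    refine natDegree_sum_le_of_forall_le _ _ fun T _ => (natDegree_C_mul_X_pow_le _ _).trans ?_
    rw [← heu]
    exact Finset.sum_le_sum_of_subset (subset_univ T)
  have hcoeff : P.coeff (e T) = principalMinorCompl A T := by
    simp only [P, finsetSum_coeff, coeff_C_mul, coeff_X_pow]
    rw [Finset.sum_eq_single T]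
    · simp
    · intro j _ hj
      rw [if_neg, mul_zero]
      intro h
      exact hj (heinj h).symm
    · simp
  rw [← hcoeff]
  refine coeff_eq_zero_of_eval_eq_zero P (2 ^ n - 1) ?_ hPd hP0 _ ?_ ?_
  · have := Nat.one_le_two_pow (n := n)
    omega
  · exact (Nat.zero_le _).trans_lt (hmono ∅ T (empty_subset _) hT.ne_empty.symm)
  · rw [← heu]
    exact hmono T univ (subset_univ _) hTu

/-- Payne's theorem on translation o-polynomials. -/
theorem exists_eq_mul_pow_two_pow {K : Type*} [Field K] [Fintype K] [CharP K 2] {n : ℕ}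
    (hn0 : n ≠ 0)
    (hn : Fintype.card K = 2 ^ n) (f : K →+ K) (hf : ∀ c : K, c ≠ 0 → ∃ x, x ≠ 0 ∧ f x = c * x) :
    ∃ i : ℕ, Nat.gcd i n = 1 ∧ ∃ c : K, c ≠ 0 ∧ ∀ x, f x = c * x ^ 2 ^ i := by
  have : NeZero n := ⟨hn0⟩
  obtain ⟨a, ha⟩ := exists_eq_sum_pow_two_pow hn f
  set A : Matrix (ZMod n) (ZMod n) K := Matrix.of fun j l => a (l - j) ^ 2 ^ j.val with hA
  have hwalk : ∀ r, 0 < r → r < n → ¬ HasClosedWalk A r := by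
    intro r hr hrn
    refine not_hasClosedWalk A (fun T hT hTu => ?_) r hr (by rwa [ZMod.card])
    exact principalMinorCompl_dickson_eq_zero hn a (fun c hc => by simpa only [ha] using hf c hc)
      T hT hTu
  have hAne : ∀ j l, a (l - j) ≠ 0 → A j l ≠ 0 := fun j l h => pow_ne_zero _ h
  -- The digraph has the steps `l → l - i` with `a i ≠ 0`; repeating a single such step closes up
  -- after `addOrderOf i` steps.
  have hcop : ∀ i, a i ≠ 0 → addOrderOf i = n := by
    intro i hi
    by_contra hne
    have hdvd : addOrderOf i ∣ n := by simpa using addOrderOf_dvd_card (x := i)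
    have hpos : 0 < addOrderOf i := addOrderOf_pos i
    refine hwalk _ hpos (lt_of_le_of_ne (Nat.le_of_dvd (NeZero.pos n) hdvd) hne) ?_
    refine ⟨fun t => -(t • i), fun t => hAne _ _ ?_, fun t => ?_⟩
    · beta_reduce
      rwa [succ_nsmul, show -(t • i) - -(t • i + i) = i by abel]
    · beta_reduce
      rw [add_nsmul, addOrderOf_nsmul_eq_zero, add_zero]
  obtain ⟨i, hi⟩ : ∃ i, a i ≠ 0 := by
    by_contra! h
    obtain ⟨x, hx, hx1⟩ := hf 1 one_ne_zero
    rw [ha] at hx1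
    simp [h] at hx1
    exact hx hx1.symm
  have huniq : ∀ j, j ≠ i → a j = 0 := by
    intro j hji
    by_contra hj
    have hord := hcop i hi
    obtain ⟨m, hmn, hm⟩ : ∃ m < n, m • i = j := by
      have hz : j ∈ AddSubgroup.zmultiples i := by
        have : AddSubgroup.zmultiples i = ⊤ := by
          refine AddSubgroup.eq_top_of_card_eq _ ?_
          rw [Nat.card_zmultiples, hord, Nat.card_zmod]
        rw [this]; trivial
      have := (mem_zmultiples_iff_mem_range_addOrderOf).1 hz
      rw [hord] at this
      simpa using this
    have hm0 : m ≠ 0 := by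
      rintro rfl
      have := hcop j hj
      rw [← hm, zero_nsmul, addOrderOf_zero] at this
      subst this
      exact hji (Subsingleton.elim _ _)
    have hm1 : m ≠ 1 := by
      rintro rfl
      exact hji (by simpa using hm.symm)
    -- One step by `j = m • i` and then `n - m` steps by `i` lead back to `0`. As `m ≥ 2`, this walk
    -- is shorter than `n`.
    refine hwalk (n - m + 1) (by omega) (by omega) (hasClosedWalk_of_walk (by omega)
      (fun t => if t = 0 then 0 else -(j + (t - 1) • i)) ?_ ?_)
    · intro t _
      refine hAne _ _ ?_
      rcases t with _ | t
      · simpa using hj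
      · simp only [Nat.succ_ne_zero, if_false, Nat.add_sub_cancel, succ_nsmul]
        rwa [show -(j + t • i) - -(j + (t • i + i)) = i by abel]
    · simp only [Nat.succ_ne_zero, if_false, if_true, Nat.add_sub_cancel]
      rw [← hm, ← add_nsmul, Nat.add_sub_cancel' hmn.le, nsmul_eq_mul, ZMod.natCast_self,
        zero_mul, neg_zero]
  refine ⟨i.val, ?_, a i, hi, fun x => ?_⟩
  · have h1 := hcop i hi
    rw [← ZMod.natCast_zmod_val i, ZMod.addOrderOf_coe _ hn0] at h1
    have hd : Nat.gcd n i.val ∣ n := Nat.gcd_dvd_left _ _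
    rw [Nat.gcd_comm]
    rcases Nat.div_eq_self.1 h1 with h | h
    · exact absurd h hn0
    · exact h
  · rw [ha, Finset.sum_eq_single i]
    · intro j _ hj
      rw [huniq j hj, zero_mul]
    · simp

end Payne

/-! ### Linear sets of pseudoregulus type -/

section Pseudoregulus

theorem charP_two_of_natCard {K : Type*} [Field K] {n : ℕ} (hn : Nat.card K = 2 ^ n) :
    CharP K 2 := by
  have : Finite K := Nat.finite_of_card_ne_zero (by rw [hn]; positivity)
  have := Fintype.ofFinite K
  refine CharTwo.of_one_ne_zero_of_two_eq_zero one_ne_zero ?_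
  have h := FiniteField.cast_card_eq_zero K
  rw [← Nat.card_eq_fintype_card, hn] at h
  push_cast at h
  exact (pow_eq_zero_iff fun h0 => by simp [h0] at h).1 h

/-- This makes `c ↦ c ^ (2 ^ i - 1)` a bijection of the unit group. Its injectivity gives
scatteredness, and its surjectivity finds points of `D` on the lines of the pseudoregulus. -/
theorem coprime_two_pow_sub_one {i n : ℕ} (h : Nat.gcd i n = 1) :
    Nat.Coprime (2 ^ n - 1) (2 ^ i - 1) := by
  rw [Nat.Coprime, Nat.pow_sub_one_gcd_pow_sub_one, Nat.gcd_comm, h, pow_one]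

theorem natCard_units_of_natCard {K : Type*} [Field K] {n : ℕ} (hn : Nat.card K = 2 ^ n) :
    Nat.card Kˣ = 2 ^ n - 1 := by
  rw [Nat.card_units, hn]

theorem eq_one_of_pow_two_pow_eq {K : Type*} [Field K] {n i : ℕ} (hn : Nat.card K = 2 ^ n)
    (hi : Nat.gcd i n = 1) {c : K} (hc : c ≠ 0) (h : c ^ 2 ^ i = c) : c = 1 := by
  have : Finite K := Nat.finite_of_card_ne_zero (by rw [hn]; positivity)
  have h1 : Units.mk0 c hc ^ (2 ^ i - 1) = 1 := by
    ext
    have h2 : c ^ (2 ^ i - 1) * c = c := by rw [← pow_succ, Nat.sub_add_cancel Nat.one_le_two_pow, h]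
    simpa [hc] using h2
  have h2 : Units.mk0 c hc ^ (2 ^ n - 1) = 1 := by
    rw [← natCard_units_of_natCard hn, pow_card_eq_one']
  have h3 := pow_gcd_eq_one.2 ⟨h2, h1⟩
  rw [(coprime_two_pow_sub_one hi).gcd_eq_one, pow_one] at h3
  exact congrArg Units.val h3

theorem exists_pow_two_pow_eq_mul {K : Type*} [Field K] {n i : ℕ} (hn : Nat.card K = 2 ^ n)
    (hi : Nat.gcd i n = 1) {b : K} (hb : b ≠ 0) : ∃ c : K, c ≠ 0 ∧ c ^ 2 ^ i = b * c := by
  have : Finite K := Nat.finite_of_card_ne_zero (by rw [hn]; positivity)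
  have hcop : (Nat.card Kˣ).Coprime (2 ^ i - 1) := by
    rw [natCard_units_of_natCard hn]; exact coprime_two_pow_sub_one hi
  obtain ⟨c, hc⟩ := (powCoprime hcop).surjective (Units.mk0 b hb)
  refine ⟨c, c.ne_zero, ?_⟩
  have hc' : (c : K) ^ (2 ^ i - 1) = b := by
    simpa using congrArg Units.val hc
  rw [← hc', ← pow_succ, Nat.sub_add_cancel Nat.one_le_two_pow]

theorem pow_two_pow_injective {K : Type*} [Field K] [CharP K 2] (i : ℕ) :
    Function.Injective fun x : K => x ^ 2 ^ i := by
  intro x y h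
  exact (iterateFrobenius K 2 i).injective (by simpa [iterateFrobenius_def] using h)

theorem pow_two_pow_surjective {K : Type*} [Field K] [CharP K 2] [Finite K] (i : ℕ) :
    Function.Surjective fun x : K => x ^ 2 ^ i :=
  Finite.surjective_of_injective (pow_two_pow_injective i)

theorem eq_zero_or_eq_one_of_card_two {F : Type*} [Field F] (hF : Nat.card F = 2) (c : F) :
    c = 0 ∨ c = 1 := by
  have : Finite F := Nat.finite_of_card_ne_zero (by omega)
  have := Fintype.ofFinite F
  have h := FiniteField.pow_card c
  rw [← Nat.card_eq_fintype_card, hF] at h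
  rcases eq_or_ne c 0 with h0 | h0
  · exact Or.inl h0
  · right
    exact mul_left_cancel₀ h0 (by rw [mul_one, ← sq, h])

variable {F K W : Type*} [Field F] [Field K] [Algebra F K] [AddCommGroup W] [Module F W]

/-- The `F₂`-subspace `{e (u, u ^ 2 ^ i)}`. -/
def frobeniusGraph [CharP K 2] (F₂ : Subfield F) (hF₂ : Nat.card F₂ = 2) (e : (K × K) ≃ₗ[F] W)
    (i : ℕ) : Submodule F₂ W where
  carrier := Set.range fun u : K => e (u, u ^ 2 ^ i)
  add_mem' := by
    rintro _ _ ⟨u, rfl⟩ ⟨v, rfl⟩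
    exact ⟨u + v, by simp only [← map_add, Prod.mk_add_mk, add_pow_char_pow]⟩
  zero_mem' := ⟨0, by simp⟩
  smul_mem' := by
    rintro c _ ⟨u, rfl⟩
    rcases eq_zero_or_eq_one_of_card_two hF₂ c with rfl | rfl
    · exact ⟨0, by simp⟩
    · exact ⟨u, by simp⟩

/-- The subspace of the vectors `e (a u, b u ^ 2 ^ i)` with `a, b` in `F`. -/
def pseudoregulusLine (e : (K × K) ≃ₗ[F] W) (i : ℕ) (u : K) : Submodule F W :=
  Submodule.span F {e (u, 0), e (0, u ^ 2 ^ i)}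

theorem mem_pseudoregulusLine {e : (K × K) ≃ₗ[F] W} {i : ℕ} {u : K} {w : W} :
    w ∈ pseudoregulusLine e i u ↔ ∃ a b : F, w = e (a • u, b • u ^ 2 ^ i) := by
  rw [pseudoregulusLine, Submodule.mem_span_pair]
  refine exists_congr fun a => exists_congr fun b => ?_
  rw [← map_smul, ← map_smul, ← map_add, eq_comm]
  simp

theorem finrank_pseudoregulusLine (e : (K × K) ≃ₗ[F] W) (i : ℕ) {u : K} (hu : u ≠ 0) :
    Module.finrank F (pseudoregulusLine e i u) = 2 := by
  have hli : LinearIndependent F ![e (u, 0), e (0, u ^ 2 ^ i)] := by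
    rw [LinearIndependent.pair_iff]
    intro a b hab
    rw [← map_smul, ← map_smul, ← map_add, map_eq_zero_iff _ e.injective] at hab
    simpa [hu] using hab
  have := finrank_span_eq_card hli
  rwa [Matrix.range_cons_cons_empty, Fintype.card_fin] at this

theorem le_iff_rep_mem {x : ℙ F W} {M : Submodule F W} : x.submodule ≤ M ↔ x.rep ∈ M := by
  rw [Projectivization.submodule_eq, Submodule.span_singleton_le_iff_mem]

theorem mk_mem_projPoints {w : W} (hw : w ≠ 0) {M : Submodule F W} :
    Projectivization.mk F w hw ∈ projPoints M ↔ w ∈ M := by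
  rw [projPoints, Set.mem_ofPred_eq, Projectivization.submodule_mk,
    Submodule.span_singleton_le_iff_mem]

/-- Makes the lines with non-proportional parameters disjoint, so that they can be indexed by the
points of `ℙ F K`. If only the second coordinates can be compared, the ratio comes from a `2 ^ i`-th
root in `F`. -/
theorem exists_smul_of_mem_pseudoregulusLine [Finite F] [CharP F 2] [CharP K 2]
    {e : (K × K) ≃ₗ[F] W} {i : ℕ}
    {u v : K} {w : W}
    (hw : w ≠ 0) (hu : w ∈ pseudoregulusLine e i u) (hv : w ∈ pseudoregulusLine e i v) :
    ∃ c : F, v = c • u := by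
  obtain ⟨a, b, hab⟩ := mem_pseudoregulusLine.1 hu
  obtain ⟨a', b', hab'⟩ := mem_pseudoregulusLine.1 hv
  have h := e.injective (hab.symm.trans hab')
  rw [Prod.mk.injEq] at h
  by_cases ha : a' = 0
  · have hb : b' ≠ 0 := by
      rintro rfl
      apply hw
      rw [hab', ha]
      simp
    obtain ⟨c, hc⟩ := pow_two_pow_surjective i (b'⁻¹ * b)
    refine ⟨c, pow_two_pow_injective i ?_⟩
    beta_reduce at hc ⊢
    rw [smul_pow, hc, mul_smul, h.2, inv_smul_smul₀ hb]
  · exact ⟨a'⁻¹ * a, by rw [mul_smul, h.1, inv_smul_smul₀ ha]⟩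

/-- The transversal spaces of the pseudoregulus are `K × 0` and `0 × K`. -/
theorem transversal_iff [Finite F] [CharP K 2] [FiniteDimensional F K] {h i : ℕ}
    (hF : Nat.card F = 2 ^ h)
    (hi : Nat.gcd i h = 1) (e : (K × K) ≃ₗ[F] W) (D : Set (ℙ F W))
    (hD : ∀ d, d ∈ D ↔ ∃ u : K, u ≠ 0 ∧ d.submodule = Submodule.span F {e (u, u ^ 2 ^ i)})
    (T : Submodule F W) :
    (Module.finrank F T = Module.finrank F K ∧ Disjoint (projPoints T) D ∧
      ∀ u : K, u ≠ 0 → (projPoints T ∩ projPoints (pseudoregulusLine e i u)).Nonempty) ↔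
    (T = LinearMap.range (e.toLinearMap ∘ₗ LinearMap.inl F K K) ∨
      T = LinearMap.range (e.toLinearMap ∘ₗ LinearMap.inr F K K)) := by
  have hinl : Function.Injective (e.toLinearMap ∘ₗ LinearMap.inl F K K) := by
    simpa using LinearMap.inl_injective (R := F) (M := K) (M₂ := K)
  have hinr : Function.Injective (e.toLinearMap ∘ₗ LinearMap.inr F K K) := by
    simpa using LinearMap.inr_injective (R := F) (M := K) (M₂ := K)
  have : FiniteDimensional F W := Module.Finite.equiv e
  constructor
  · rintro ⟨hT, hTD, hTs⟩
    -- If `T` meets the line in `(a • u, b • u ^ 2 ^ i)` with `a` and `b` both non-zero, a multiple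
    -- by some `c` in `F` has the form `(v, v ^ 2 ^ i)`, so the point is in `D`.
    have key : ∀ u : K, e (u, 0) ∈ T ∨ e (0, u ^ 2 ^ i) ∈ T := by
      intro u
      rcases eq_or_ne u 0 with rfl | hu
      · left; simp [← Prod.zero_eq_mk]
      obtain ⟨x, hxT, hxs⟩ := hTs u hu
      rw [projPoints, Set.mem_ofPred_eq, le_iff_rep_mem] at hxT hxs
      obtain ⟨a, b, hab⟩ := mem_pseudoregulusLine.1 hxs
      by_cases ha : a = 0
      · have hb : b ≠ 0 := by
          rintro rfl
          exact x.rep_nonzero (by rw [hab, ha]; simp)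
        right
        have := T.smul_mem b⁻¹ hxT
        rw [hab, ← map_smul] at this
        simpa [ha, smul_smul, hb] using this
      by_cases hb : b = 0
      · left
        have := T.smul_mem a⁻¹ hxT
        rw [hab, ← map_smul] at this
        simpa [ha, smul_smul, hb] using this
      exfalso
      obtain ⟨c, hc, hcb⟩ := exists_pow_two_pow_eq_mul hF hi
        (mul_ne_zero hb (inv_ne_zero (pow_ne_zero (2 ^ i) ha)))
      have hxT' : x ∈ projPoints T := le_iff_rep_mem.2 hxT
      refine Set.disjoint_left.1 hTD hxT' ((hD x).2 ⟨(c * a) • u, smul_ne_zero (mul_ne_zero hc ha) hu, ?_⟩)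
      have : e ((c * a) • u, ((c * a) • u) ^ 2 ^ i) = c • x.rep := by
        rw [hab, ← map_smul, smul_pow, mul_pow, hcb, Prod.smul_mk, smul_smul, smul_smul]
        congr 3
        field_simp
      rw [this, Projectivization.submodule_eq, Submodule.span_singleton_smul_eq hc.isUnit]
    -- The two alternatives of `key` define additive subgroups of `K`, and a group is not the union
    -- of two proper subgroups.
    have hor : (∀ u : K, e (u, 0) ∈ T) ∨ ∀ u : K, e (0, u ^ 2 ^ i) ∈ T := by
      by_contra! hcon
      obtain ⟨⟨u, hu⟩, v, hv⟩ := hcon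
      have hu' := (key u).resolve_left hu
      have hv' := (key v).resolve_right hv
      rcases key (u + v) with h' | h'
      · apply hu
        have := T.sub_mem h' hv'
        rw [← map_sub] at this
        simpa using this
      · apply hv
        have := T.sub_mem h' hu'
        rw [← map_sub, add_pow_char_pow] at this
        simpa using this
    rcases hor with hA | hB
    · left
      refine (Submodule.eq_of_le_of_finrank_eq ?_ ?_).symm
      · rintro _ ⟨u, rfl⟩
        exact hA u
      · rw [hT, LinearMap.finrank_range_of_inj hinl]
    · right
      have : Finite K := Module.finite_of_finite F
      refine (Submodule.eq_of_le_of_finrank_eq ?_ ?_).symm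
      · rintro _ ⟨u, rfl⟩
        obtain ⟨v, rfl⟩ := pow_two_pow_surjective i u
        exact hB v
      · rw [hT, LinearMap.finrank_range_of_inj hinr]
  · have hdisj : ∀ T : Submodule F W, (∀ u : K, u ≠ 0 → e (u, u ^ 2 ^ i) ∉ T) →
        Disjoint (projPoints T) D := by
      intro T hT
      rw [Set.disjoint_left]
      intro x hx hxD
      obtain ⟨u, hu, hxu⟩ := (hD x).1 hxD
      refine hT u hu ?_
      rwa [projPoints, Set.mem_ofPred_eq, hxu, Submodule.span_singleton_le_iff_mem] at hx
    have hne : ∀ (T : Submodule F W) (u : K) (w : W), w ≠ 0 → w ∈ T →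
        w ∈ pseudoregulusLine e i u →
        (projPoints T ∩ projPoints (pseudoregulusLine e i u)).Nonempty := by
      intro T u w hw h1 h2
      exact ⟨Projectivization.mk F w hw, (mk_mem_projPoints hw).2 h1, (mk_mem_projPoints hw).2 h2⟩
    rintro (rfl | rfl)
    · refine ⟨LinearMap.finrank_range_of_inj hinl, hdisj _ ?_, fun u hu => ?_⟩
      · rintro u hu ⟨v, hv⟩
        have := e.injective hv
        simp at this
        exact hu (pow_eq_zero_iff (by positivity) |>.1 this.2.symm)
      · refine hne _ u (e (u, 0)) (by simpa using hu) ⟨u, rfl⟩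
          (mem_pseudoregulusLine.2 ⟨1, 0, by simp⟩)
    · refine ⟨LinearMap.finrank_range_of_inj hinr, hdisj _ ?_, fun u hu => ?_⟩
      · rintro u hu ⟨v, hv⟩
        have := e.injective hv
        simp at this
        exact hu this.1.symm
      · refine hne _ u (e (0, u ^ 2 ^ i)) (by simpa using hu) ⟨_, rfl⟩
          (mem_pseudoregulusLine.2 ⟨0, 1, by simp⟩)

/-- The points in question come from the multiples `c • u` with `c` in `Fˣ`. Two of them agree only
if the ratio of the parameters is fixed by `x ↦ x ^ 2 ^ i`, so equals `1`. -/
theorem ncard_inter_pseudoregulusLine {n i : ℕ} (hK : Nat.card K = 2 ^ n)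
    (hi : Nat.gcd i n = 1) (e : (K × K) ≃ₗ[F] W) (D : Set (ℙ F W))
    (hD : ∀ d, d ∈ D ↔ ∃ u : K, u ≠ 0 ∧ d.submodule = Submodule.span F {e (u, u ^ 2 ^ i)})
    {u : K} (hu : u ≠ 0) :
    (D ∩ projPoints (pseudoregulusLine e i u)).ncard = Nat.card F - 1 := by
  have hne : ∀ c : Fˣ, e ((c : F) • u, ((c : F) • u) ^ 2 ^ i) ≠ 0 := by
    intro c
    simp [hu]
  let f : Fˣ → ℙ F W := fun c => Projectivization.mk F _ (hne c)
  have hf : Function.Injective f := by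
    intro c c' hcc
    obtain ⟨a, ha⟩ := (Projectivization.mk_eq_mk_iff' F _ _ (hne c) (hne c')).1 hcc
    rw [← map_smul] at ha
    have := e.injective ha
    simp only [Prod.smul_mk, Prod.mk.injEq, smul_pow, smul_smul] at this
    have h1 := smul_left_injective F hu this.1
    have h2 := smul_left_injective F (pow_ne_zero (2 ^ i) hu) this.2
    beta_reduce at h1 h2
    rw [← h1, mul_pow] at h2
    have h3 := mul_right_cancel₀ (pow_ne_zero _ c'.ne_zero) h2
    have ha0 : a ≠ 0 := by
      rintro rfl
      rw [zero_mul] at h1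
      exact c.ne_zero h1.symm
    have h4 : algebraMap F K a = 1 := by
      refine eq_one_of_pow_two_pow_eq hK hi (by simpa using ha0) ?_
      rw [← map_pow, ← h3]
    have h5 : a = 1 := by
      rwa [map_eq_one_iff _ (algebraMap F K).injective] at h4
    rw [h5, one_mul] at h1
    exact Units.ext h1.symm
  have hr : D ∩ projPoints (pseudoregulusLine e i u) = Set.range f := by
    ext x
    constructor
    · rintro ⟨hxD, hxs⟩
      obtain ⟨v, hv, hxv⟩ := (hD x).1 hxD
      rw [projPoints, Set.mem_ofPred_eq, hxv, Submodule.span_singleton_le_iff_mem,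
        mem_pseudoregulusLine] at hxs
      obtain ⟨a, b, hab⟩ := hxs
      have := e.injective hab
      rw [Prod.mk.injEq] at this
      have ha : a ≠ 0 := by
        rintro rfl
        exact hv (by simpa using this.1)
      refine ⟨Units.mk0 a ha, Projectivization.submodule_injective ?_⟩
      simp only [f]
      rw [Projectivization.submodule_mk, hxv, this.1]
      rfl
    · rintro ⟨c, rfl⟩
      refine ⟨(hD _).2 ⟨(c : F) • u, smul_ne_zero c.ne_zero hu,
        Projectivization.submodule_mk _ _⟩, (mk_mem_projPoints _).2 ?_⟩
      exact mem_pseudoregulusLine.2 ⟨c, (c : F) ^ 2 ^ i, by rw [smul_pow]⟩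
  rw [hr, Set.ncard_range_of_injective hf, Nat.card_units]

theorem isScatteredLinearSet_of_eq_frobeniusGraph [CharP K 2] {n i : ℕ} (hK : Nat.card K = 2 ^ n)
    (hi : Nat.gcd i n = 1) (F₂ : Subfield F) (hF₂ : Nat.card F₂ = 2)
    (e : (K × K) ≃ₗ[F] W) (D : Set (ℙ F W))
    (hD : ∀ d, d ∈ D ↔ ∃ u : K, u ≠ 0 ∧ d.submodule = Submodule.span F {e (u, u ^ 2 ^ i)}) :
    IsScatteredLinearSet F₂ n D := by
  have : Finite K := Nat.finite_of_card_ne_zero (by rw [hK]; positivity)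
  have : Finite W := Finite.of_equiv _ e.toEquiv
  refine ⟨frobeniusGraph F₂ hF₂ e i, ?_, ?_, ?_⟩
  · have hinj : Function.Injective fun u : K => e (u, u ^ 2 ^ i) := by
      intro u v huv
      have := e.injective huv
      rw [Prod.mk.injEq] at this
      exact this.1
    have h1 : Nat.card (frobeniusGraph F₂ hF₂ e i) = 2 ^ n := by
      rw [← hK]
      exact Nat.card_range_of_injective hinj
    have h2 := Module.natCard_eq_pow_finrank (K := F₂) (V := frobeniusGraph F₂ hF₂ e i)
    rw [h1, hF₂] at h2
    exact (Nat.pow_right_injective le_rfl h2).symm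
  · rintro _ ⟨u, rfl⟩ _ ⟨v, rfl⟩ hu0 hv0 ⟨c, hc⟩
    beta_reduce at hc hu0 hv0 ⊢
    rw [← map_smul] at hc
    have := e.injective hc
    simp only [Prod.smul_mk, Prod.mk.injEq] at this
    have hu : u ≠ 0 := by
      rintro rfl
      simp at hu0
    have hv : v ≠ 0 := by
      rintro rfl
      simp at hv0
    have hc0 : c ≠ 0 := by
      rintro rfl
      exact hv (by simpa using this.1)
    have h2 := this.2
    rw [this.1, smul_pow] at h2
    have h3 := smul_left_injective F (pow_ne_zero (2 ^ i) hu) h2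
    have h4 : algebraMap F K c = 1 := by
      refine eq_one_of_pow_two_pow_eq hK hi (by simpa using hc0) ?_
      rw [← map_pow]
      exact congrArg _ h3
    refine ⟨1, ?_⟩
    rw [map_eq_one_iff _ (algebraMap F K).injective] at h4
    rw [one_smul, this.1, h4, one_smul]
  · ext x
    rw [hD]
    constructor
    · rintro ⟨u, hu, hx⟩
      have hne : e (u, u ^ 2 ^ i) ≠ 0 := by simp [hu]
      refine ⟨_, ⟨u, rfl⟩, hne, Projectivization.submodule_injective ?_⟩
      rw [hx, Projectivization.submodule_mk]
    · rintro ⟨_, ⟨u, rfl⟩, hu, rfl⟩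
      refine ⟨u, ?_, Projectivization.submodule_mk _ _⟩
      rintro rfl
      simp at hu

theorem isPseudoregulusType_of_eq_frobeniusGraph {h k i : ℕ} (hh : 2 ≤ h) (hk : 2 ≤ k)
    (hF : Nat.card F = 2 ^ h) (hK : Module.finrank F K = k) (hi : Nat.gcd i (h * k) = 1)
    (F₂ : Subfield F) (hF₂ : Nat.card F₂ = 2) (e : (K × K) ≃ₗ[F] W) (D : Set (ℙ F W))
    (hD : ∀ d, d ∈ D ↔ ∃ u : K, u ≠ 0 ∧ d.submodule = Submodule.span F {e (u, u ^ 2 ^ i)}) :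
    IsPseudoregulusType F₂ k h D := by
  have : FiniteDimensional F K := Module.finite_of_finrank_pos (by omega)
  have : Finite F := Nat.finite_of_card_ne_zero (by rw [hF]; positivity)
  have hKc : Nat.card K = 2 ^ (h * k) := by
    rw [Module.natCard_eq_pow_finrank (K := F), hF, hK, pow_mul]
  have : Finite K := Nat.finite_of_card_ne_zero (by rw [hKc]; positivity)
  have := charP_two_of_natCard hF
  have := charP_two_of_natCard hKc
  have hih : Nat.gcd i h = 1 := Nat.Coprime.coprime_mul_right_right hi
  refine ⟨hh, hk, ?_, ?_, ?_, ?_⟩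
  · have h2 := Module.natCard_eq_pow_finrank (K := F₂) (V := F)
    rw [hF, hF₂] at h2
    exact (Nat.pow_right_injective le_rfl h2).symm
  · rw [← e.finrank_eq, Module.finrank_prod, hK, two_mul]
  · rw [mul_comm k h]
    exact isScatteredLinearSet_of_eq_frobeniusGraph hKc hi F₂ hF₂ e D hD
  · have hcard : Nat.card (ℙ F K) =
        (Nat.card F₂ ^ (h * k) - 1) / (Nat.card F₂ ^ h - 1) := by
      rw [Projectivization.card'', hKc, hF, hF₂]
    let E : Fin ((Nat.card F₂ ^ (h * k) - 1) / (Nat.card F₂ ^ h - 1)) ≃ ℙ F K :=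
      (finCongr hcard.symm).trans (Finite.equivFin (ℙ F K)).symm
    refine ⟨fun j => pseudoregulusLine e i (E j).rep,
      fun j => finrank_pseudoregulusLine e i (E j).rep_nonzero, ?_, ?_, ?_⟩
    · intro j j' hjj
      rw [Set.disjoint_left]
      intro x hx hx'
      rw [projPoints, Set.mem_ofPred_eq, le_iff_rep_mem] at hx hx'
      obtain ⟨c, hc⟩ := exists_smul_of_mem_pseudoregulusLine x.rep_nonzero hx' hx
      apply hjj
      apply E.injective
      rw [← (E j).mk_rep, ← (E j').mk_rep, Projectivization.mk_eq_mk_iff']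
      exact ⟨c, hc.symm⟩
    · intro j
      rw [ncard_inter_pseudoregulusLine hKc hi e D hD (E j).rep_nonzero, hF, hF₂]
      simp
    -- Replacing `u` by `a • u` only rescales the two spanning vectors, so representatives of the
    -- points of `ℙ F K` account for every `u`.
    · have hline : ∀ T : Submodule F W,
          (∀ j, (projPoints T ∩ projPoints (pseudoregulusLine e i (E j).rep)).Nonempty) ↔
          ∀ u : K, u ≠ 0 → (projPoints T ∩ projPoints (pseudoregulusLine e i u)).Nonempty := by
        intro T
        refine ⟨fun hT u hu => ?_, fun hT j => hT _ (E j).rep_nonzero⟩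
        obtain ⟨j, hj⟩ := E.surjective (Projectivization.mk F u hu)
        obtain ⟨a, ha⟩ := Projectivization.exists_smul_eq_mk_rep F u hu
        obtain ⟨x, hxT, hx⟩ := hT j
        refine ⟨x, hxT, ?_⟩
        rw [projPoints, Set.mem_ofPred_eq, le_iff_rep_mem] at hx ⊢
        rw [hj, ← ha, mem_pseudoregulusLine] at hx
        obtain ⟨b, c, hbc⟩ := hx
        refine mem_pseudoregulusLine.2 ⟨b * a, c * (a : F) ^ 2 ^ i, ?_⟩
        rw [hbc, Units.smul_def, smul_pow, smul_smul, smul_smul]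
      have hset := fun T => transversal_iff hF hih e D hD T
      have hne : LinearMap.range (e.toLinearMap ∘ₗ LinearMap.inl F K K) ≠
          LinearMap.range (e.toLinearMap ∘ₗ LinearMap.inr F K K) := by
        intro heq
        have : e (1, 0) ∈ LinearMap.range (e.toLinearMap ∘ₗ LinearMap.inr F K K) := by
          rw [← heq]; exact ⟨1, rfl⟩
        obtain ⟨v, hv⟩ := this
        have := e.injective hv
        simp at this
      rw [← Set.ncard_pair hne]
      congr 1
      ext T
      rw [Set.mem_ofPred_eq, hline, ← hK]
      exact hset T

end Pseudoregulus

/-! ### Translation hyperovals in affine coordinates -/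

section Planes

variable {P P' : Type*} {L : Set (Set P)} {L' : Set (Set P')} {φ : P ≃ P'}

theorem IsPlaneIso.symm (hφ : IsPlaneIso L L' φ) : IsPlaneIso L' L φ.symm := by
  intro m
  rw [hφ, Equiv.image_symm_image]

theorem IsPlaneIso.isElation_conj (hφ : IsPlaneIso L L' φ) {a : Set P} {σ : P ≃ P}
    (hσ : IsElation L a σ) : IsElation L' (φ '' a) ((φ.symm.trans σ).trans φ) := by
  obtain ⟨hσL, hfix, C, hC, hCm⟩ := hσ
  have himg : ∀ m : Set P', ((φ.symm.trans σ).trans φ) '' m = φ '' (σ '' (φ.symm '' m)) := by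
    intro m
    simp only [Set.image_image]
    rfl
  refine ⟨fun m => ?_, ?_, φ C, ⟨C, hC, rfl⟩, fun m hm hCm' => ?_⟩
  · rw [himg, ← hφ, ← hσL, ← hφ.symm m]
  · rintro _ ⟨x, hx, rfl⟩
    simp [hfix x hx]
  · rw [himg, hCm _ ((hφ.symm m).1 hm) ⟨φ C, hCm', by simp⟩]
    simp

theorem IsPlaneIso.isTranslationHyperoval_image (hφ : IsPlaneIso L L' φ) {N : ℕ} {a H : Set P}
    (hH : IsTranslationHyperoval L N a H) :
    IsTranslationHyperoval L' N (φ '' a) (φ '' H) := by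
  obtain ⟨⟨harc, hcard⟩, haL, htwo, htrans⟩ := hH
  refine ⟨⟨?_, ?_⟩, (hφ a).1 haL, ?_, ?_⟩
  · rintro _ ⟨x, hx, rfl⟩ _ ⟨y, hy, rfl⟩ _ ⟨z, hz, rfl⟩ hxy hxz hyz m hm ⟨h1, h2, h3⟩
    have hmem : ∀ w, φ w ∈ m → w ∈ φ.symm '' m := fun w hw => ⟨φ w, hw, by simp⟩
    exact harc x hx y hy z hz (ne_of_apply_ne φ hxy) (ne_of_apply_ne φ hxz)
      (ne_of_apply_ne φ hyz) _ ((hφ.symm m).1 hm) ⟨hmem x h1, hmem y h2, hmem z h3⟩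
  · rw [Set.ncard_image_of_injective _ φ.injective, hcard]
  · rw [← Set.image_inter φ.injective, Set.ncard_image_of_injective _ φ.injective, htwo]
  · rw [← Set.image_sdiff φ.injective]
    rintro _ ⟨x, hx, rfl⟩ _ ⟨y, hy, rfl⟩
    obtain ⟨σ, hσ, hσH, hσx⟩ := htrans x hx y hy
    refine ⟨_, hφ.isElation_conj hσ, ?_, by simp [hσx]⟩
    conv_rhs => rw [← hσH]
    simp only [Set.image_image]
    simp

variable {K Z : Type*} [Field K] [AddCommGroup Z] [Module K Z]

/-- Affine coordinates on the point-line geometry with line set `L` and line at infinity `a`: `pt`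
parametrises the affine points by vectors, `dir` the points at infinity by directions. -/
structure IsAffineChart (L : Set (Set P)) (a : Set P) (pt : Z → P) (dir : ℙ K Z → P) : Prop where
  pt_injective : Function.Injective pt
  pt_notMem : ∀ z, pt z ∉ a
  exists_pt : ∀ x, x ∉ a → ∃ z, pt z = x
  dir_mem : ∀ p, dir p ∈ a
  exists_dir : ∀ x ∈ a, ∃ p, dir p = x
  exists_line : ∀ z p, ∃ m ∈ L, pt z ∈ m ∧ dir p ∈ m
  pt_mem_iff : ∀ m ∈ L, ∀ z p, pt z ∈ m → dir p ∈ m → ∀ z', pt z' ∈ m ↔ z' - z ∈ p.submodule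

namespace IsAffineChart

variable {a H : Set P} {pt : Z → P} {dir : ℙ K Z → P}

/-- Elations whose axis is the line at infinity are translations. -/
theorem exists_translation (hc : IsAffineChart L a pt dir) (hZ : 2 ≤ Module.finrank K Z)
    {σ : P ≃ P} (hσ : IsElation L a σ) : ∃ v, ∀ z, σ (pt z) = pt (z + v) := by
  obtain ⟨hσL, hfix, C, hC, hCm⟩ := hσ
  obtain ⟨p, rfl⟩ := hc.exists_dir C hC
  have hs : ∀ z, ∃ z', pt z' = σ (pt z) := by
    intro z
    refine hc.exists_pt _ fun hmem => hc.pt_notMem z ?_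
    rwa [← σ.injective (hfix _ hmem)]
  choose s hs using hs
  have hcentre : ∀ z, s z - z ∈ p.submodule := by
    intro z
    obtain ⟨m, hm, hz, hp⟩ := hc.exists_line z p
    refine (hc.pt_mem_iff m hm z p hz hp _).1 ?_
    rw [hs, ← hCm m hm hp]
    exact ⟨_, hz, rfl⟩
  -- The points at infinity are fixed, so every line goes to a parallel one.
  have hpar : ∀ z z', s z' - s z ∈ Submodule.span K {z' - z} := by
    intro z z'
    rcases eq_or_ne (z' - z) 0 with h0 | h0
    · rw [sub_eq_zero.1 h0]
      simp
    · have hd := Projectivization.submodule_mk (K := K) (z' - z) h0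
      obtain ⟨m, hm, hz, hp⟩ := hc.exists_line z (Projectivization.mk K _ h0)
      have hz' : pt z' ∈ m := by
        rw [hc.pt_mem_iff m hm z _ hz hp, hd]
        exact Submodule.mem_span_singleton_self _
      have := hc.pt_mem_iff (σ '' m) ((hσL m).1 hm) (s z) (Projectivization.mk K _ h0)
        ⟨_, hz, (hs z).symm⟩ ⟨_, hp, hfix _ (hc.dir_mem _)⟩ (s z')
      rw [hd] at this
      exact this.1 ⟨_, hz', (hs z').symm⟩
  -- The difference of the two displacements is a multiple of `z' - z` and lies in the direction of
  -- the centre, hence is zero.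
  have hoff : ∀ z z', z' - z ∉ p.submodule → s z' - z' = s z - z := by
    intro z z' hzz
    obtain ⟨c, hcz⟩ := Submodule.mem_span_singleton.1 (hpar z z')
    have h1 : (c - 1) • (z' - z) ∈ p.submodule := by
      have := p.submodule.sub_mem (hcentre z') (hcentre z)
      have h2 : s z' - z' - (s z - z) = (c - 1) • (z' - z) := by
        rw [sub_smul, hcz, one_smul]; abel
      rwa [h2] at this
    have h3 : c - 1 = 0 := by
      by_contra h0
      exact hzz ((p.submodule.smul_mem_iff h0).1 h1)
    rw [sub_eq_zero.1 h3, one_smul] at hcz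
    rw [sub_eq_sub_iff_sub_eq_sub]
    exact hcz.symm
  obtain ⟨w, hw⟩ : ∃ w, w ∉ p.submodule := by
    by_contra! h
    have htop : p.submodule = ⊤ := by
      ext x; simp [h x]
    have := p.finrank_submodule
    rw [htop, finrank_top] at this
    omega
  -- When `z` lies in the direction of the centre, compare `0` and `z` through a point `w` outside
  -- it.
  have hconst : ∀ z, s z - z = s 0 - 0 := by
    intro z
    by_cases hz : z ∈ p.submodule
    · have h1 := hoff 0 w (by simpa using hw)
      have h2 := hoff w z (fun h => hw (by simpa using p.submodule.sub_mem hz h))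
      rw [h2, h1]
    · exact hoff 0 z (by simpa using hz)
  refine ⟨s 0, fun z => ?_⟩
  rw [← hs]
  congr 1
  have := hconst z
  rw [sub_zero] at this
  rw [← this]
  abel

variable [Finite K]

/-- In suitable coordinates, the affine part of a translation hyperoval through the origin is the
graph of `t ↦ t ^ 2 ^ i`. -/
theorem exists_graph_pow (hc : IsAffineChart L a pt dir) (hZ : Module.finrank K Z = 2)
    {n : ℕ} (hn0 : n ≠ 0) (hn : Nat.card K = 2 ^ n)
    (hH : IsTranslationHyperoval L (Nat.card K) a H) (h0 : pt 0 ∈ H) :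
    ∃ i : ℕ, Nat.gcd i n = 1 ∧ ∃ e : (K × K) ≃ₗ[K] Z,
      ∀ z, pt z ∈ H ↔ ∃ t : K, z = e (t, t ^ 2 ^ i) := by
  obtain ⟨⟨harc, hcard⟩, haL, htwo, htrans⟩ := hH
  have := charP_two_of_natCard hn
  have : FiniteDimensional K Z := Module.finite_of_finrank_pos (by omega)
  have : Finite Z := Module.finite_of_finite K
  have hHfin : H.Finite := Set.finite_of_ncard_ne_zero (by omega)
  have hApt : pt '' {z | pt z ∈ H} = H \ a := by
    ext x
    constructor
    · rintro ⟨z, hz, rfl⟩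
      exact ⟨hz, hc.pt_notMem z⟩
    · rintro ⟨hx, hxa⟩
      obtain ⟨z, rfl⟩ := hc.exists_pt x hxa
      exact ⟨z, hx, rfl⟩
  have hAcard : {z | pt z ∈ H}.ncard = Nat.card K := by
    rw [← Set.ncard_image_of_injective _ hc.pt_injective, hApt]
    have := Set.ncard_inter_add_ncard_sdiff_eq_ncard H a hHfin
    omega
  -- The stabilising elation that takes `pt 0` to `pt w` is the translation by `w`.
  have hadd : ∀ z w, pt z ∈ H → pt w ∈ H → pt (z + w) ∈ H := by
    intro z w hz hw
    obtain ⟨σ, hσ, hσH, hσw⟩ := htrans _ ⟨h0, hc.pt_notMem 0⟩ _ ⟨hw, hc.pt_notMem w⟩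
    obtain ⟨v, hv⟩ := hc.exists_translation hZ.ge hσ
    rw [hv, zero_add] at hσw
    rw [← hc.pt_injective hσw, ← hv, ← hσH]
    exact ⟨_, hz, rfl⟩
  have hinf : ∀ p z z', dir p ∈ H → pt z ∈ H → pt z' ∈ H → z' - z ∈ p.submodule → z' = z := by
    intro p z z' hp hz hz' hzz
    by_contra hne
    obtain ⟨m, hm, hzm, hpm⟩ := hc.exists_line z p
    have hne' : ∀ z, pt z ≠ dir p := fun z h => hc.pt_notMem z (h ▸ hc.dir_mem p)
    exact harc _ hz' _ hz _ hp (fun h => hne (hc.pt_injective h)) (hne' _) (hne' _) m hm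
      ⟨(hc.pt_mem_iff m hm z p hzm hpm z').2 hzz, hzm, hpm⟩
  obtain ⟨x₁, x₂, hx12, hx⟩ := Set.ncard_eq_two.1 htwo
  have hx1 : x₁ ∈ H ∩ a := by rw [hx]; simp
  have hx2 : x₂ ∈ H ∩ a := by rw [hx]; simp
  obtain ⟨p₁, rfl⟩ := hc.exists_dir _ hx1.2
  obtain ⟨p₂, rfl⟩ := hc.exists_dir _ hx2.2
  have hp12 : p₁ ≠ p₂ := fun h => hx12 (by rw [h])
  have hli := Projectivization.linearIndependent_pair_iff_ne.2 hp12
  rw [LinearIndependent.pair_iff] at hli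
  let e₀ : (K × K) →ₗ[K] Z := (LinearMap.toSpanSingleton K Z p₁.rep).coprod
    (LinearMap.toSpanSingleton K Z p₂.rep)
  have he₀ : ∀ x y, e₀ (x, y) = x • p₁.rep + y • p₂.rep := fun x y => by simp [e₀]
  have he₀inj : Function.Injective e₀ := by
    rw [injective_iff_map_eq_zero]
    rintro ⟨x, y⟩ hxy
    rw [he₀] at hxy
    obtain ⟨rfl, rfl⟩ := hli x y hxy
    rfl
  let e : (K × K) ≃ₗ[K] Z := LinearEquiv.ofInjectiveOfFinrankEq e₀ he₀inj (by
    rw [hZ, Module.finrank_prod, Module.finrank_self])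
  have he : ∀ x y, e (x, y) = x • p₁.rep + y • p₂.rep := he₀
  have hrep : ∀ (p : ℙ K Z) (c : K), c • p.rep ∈ p.submodule := by
    intro p c
    rw [Projectivization.submodule_eq]
    exact Submodule.smul_mem _ _ (Submodule.mem_span_singleton_self _)
  have hfun : ∀ x y y', pt (e (x, y)) ∈ H → pt (e (x, y')) ∈ H → y' = y := by
    intro x y y' hy hy'
    have := hinf p₂ _ _ hx2.1 hy hy' (by
      rw [← map_sub, Prod.mk_sub_mk, sub_self, he, zero_smul, zero_add]; exact hrep _ _)
    simpa using e.injective this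
  -- The first coordinate is injective on a set of `|K|` points, hence onto.
  have hex : ∀ x, ∃ y, pt (e (x, y)) ∈ H := by
    let g : {z | pt z ∈ H} → K := fun z => (e.symm z).1
    have hg : Function.Bijective g := by
      rw [Nat.bijective_iff_injective_and_card]
      refine ⟨?_, by rw [← hAcard, Nat.card_coe_set_eq]⟩
      rintro ⟨z, hz⟩ ⟨z', hz'⟩ hzz
      obtain ⟨⟨x, y⟩, rfl⟩ := e.surjective z
      obtain ⟨⟨x', y'⟩, rfl⟩ := e.surjective z'
      simp only [g, LinearEquiv.symm_apply_apply] at hzz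
      subst hzz
      have := hfun x y y' hz hz'
      subst this
      rfl
    intro x
    obtain ⟨⟨z, hz⟩, rfl⟩ := hg.2 x
    exact ⟨(e.symm z).2, by simpa [g] using hz⟩
  choose f hf using hex
  have hfadd : ∀ x y, f (x + y) = f x + f y := by
    intro x y
    have := hadd _ _ (hf x) (hf y)
    rw [← map_add, Prod.mk_add_mk] at this
    exact hfun _ _ _ this (hf (x + y))
  have hf0 : f 0 = 0 := by
    have := hfadd 0 0
    simpa using this
  have hfne : ∀ x, x ≠ 0 → f x ≠ 0 := by
    intro x hx hfx
    have h1 := hf x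
    rw [hfx] at h1
    have := hinf p₁ _ _ hx1.1 h0 h1 (by
      rw [sub_zero, he, zero_smul, add_zero]; exact hrep _ _)
    rw [LinearEquiv.map_eq_zero_iff] at this
    exact hx (by simpa using this)
  -- Otherwise the line of slope `c` through the origin would contain three points of `H`.
  have hslope : ∀ c x y, x ≠ 0 → y ≠ 0 → f x = c * x → f y = c * y → x = y := by
    intro c x y hx hy hfx hfy
    by_contra hxy
    have hd0 : e (1, c) ≠ 0 := by simp
    obtain ⟨m, hm, hzm, hpm⟩ := hc.exists_line 0 (Projectivization.mk K _ hd0)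
    have hmem : ∀ t, f t = c * t → pt (e (t, f t)) ∈ m := by
      intro t ht
      rw [hc.pt_mem_iff m hm 0 _ hzm hpm, sub_zero, Projectivization.submodule_mk,
        Submodule.mem_span_singleton]
      exact ⟨t, by rw [← map_smul, ht, Prod.smul_mk, smul_eq_mul, smul_eq_mul, mul_one, mul_comm]⟩
    have hne : ∀ t, t ≠ 0 → pt 0 ≠ pt (e (t, f t)) := by
      intro t ht h
      have := hc.pt_injective h
      rw [eq_comm, LinearEquiv.map_eq_zero_iff] at this
      exact ht (by simpa using congrArg Prod.fst this)
    refine harc _ h0 _ (hf x) _ (hf y) (hne x hx) (hne y hy) (fun h => hxy ?_) m hm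
      ⟨hzm, hmem x hfx, hmem y hfy⟩
    have := e.injective (hc.pt_injective h)
    simpa using congrArg Prod.fst this
  have hsurj : ∀ c : K, c ≠ 0 → ∃ x, x ≠ 0 ∧ f x = c * x := by
    let g : Kˣ → Kˣ := fun x => Units.mk0 (f x * (x : K)⁻¹)
      (mul_ne_zero (hfne _ x.ne_zero) (inv_ne_zero x.ne_zero))
    have hg : ∀ x : Kˣ, f x = g x * x := fun x => by simp [g]
    have hginj : Function.Injective g := by
      intro x y hxy
      exact Units.ext (hslope (g x) x y x.ne_zero y.ne_zero (hg x) (by rw [hxy]; exact hg y))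
    intro c hc0
    obtain ⟨x, hx⟩ := Finite.surjective_of_injective hginj (Units.mk0 c hc0)
    exact ⟨x, x.ne_zero, by rw [hg, hx]; rfl⟩
  have := Fintype.ofFinite K
  obtain ⟨i, hi, c, hc0, hfc⟩ := exists_eq_mul_pow_two_pow hn0
    (by rw [← Nat.card_eq_fintype_card, hn]) (AddMonoidHom.mk' f hfadd) hsurj
  refine ⟨i, hi, ((LinearEquiv.refl K K).prodCongr
    (LinearEquiv.smulOfNeZero K K c hc0)).trans e, fun z => ?_⟩
  have hgraph : ∀ t : K, (((LinearEquiv.refl K K).prodCongr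
      (LinearEquiv.smulOfNeZero K K c hc0)).trans e) (t, t ^ 2 ^ i) = e (t, f t) := by
    intro t
    have := hfc t
    rw [AddMonoidHom.mk'_apply] at this
    simp [this]
  simp only [hgraph]
  constructor
  · intro hz
    obtain ⟨⟨x, y⟩, rfl⟩ := e.surjective z
    exact ⟨x, by rw [hfun x y (f x) hz (hf x)]⟩
  · rintro ⟨t, rfl⟩
    exact hf t

end IsAffineChart

end Planes

/-! ### Coordinates on the André/Bruck-Bose plane -/

section BruckBose

open Module

variable {F K : Type*} [Field F] [Field K] [Algebra F K] {V : Type*} [AddCommGroup V] [Module F V]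
  {Hinf : Submodule F V}

/-- The subspace of `V` underlying a point of the projective line over the extension field. -/
def spreadElement (e : (Fin 2 → K) ≃ₗ[F] Hinf) (p : ℙ K (Fin 2 → K)) : Submodule F V :=
  ((p.submodule.restrictScalars F).map e.toLinearMap).map Hinf.subtype

theorem mem_spreadElement {e : (Fin 2 → K) ≃ₗ[F] Hinf} {p : ℙ K (Fin 2 → K)} {v : V} :
    v ∈ spreadElement e p ↔ ∃ z ∈ p.submodule, (e z : V) = v := by
  simp only [spreadElement, Submodule.mem_map, Submodule.restrictScalars_mem]
  constructor
  · rintro ⟨_, ⟨z, hz, rfl⟩, rfl⟩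
    exact ⟨z, hz, rfl⟩
  · rintro ⟨z, hz, rfl⟩
    exact ⟨_, ⟨z, hz, rfl⟩, rfl⟩

theorem coe_mem_spreadElement {e : (Fin 2 → K) ≃ₗ[F] Hinf} {p : ℙ K (Fin 2 → K)}
    {z : Fin 2 → K} : (e z : V) ∈ spreadElement e p ↔ z ∈ p.submodule := by
  rw [mem_spreadElement]
  constructor
  · rintro ⟨z', hz', h⟩
    rwa [← e.injective (Subtype.ext h)]
  · exact fun hz => ⟨z, hz, rfl⟩

theorem smul_add_coe_mem_iff {w₀ : V} (hw₀ : w₀ ∉ Hinf) {c : F} {v : Hinf} :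
    c • w₀ + (v : V) ∈ Hinf ↔ c = 0 := by
  rw [Submodule.add_mem_iff_left _ v.2]
  constructor
  · intro h
    by_contra hc
    exact hw₀ ((Hinf.smul_mem_iff hc).1 h)
  · rintro rfl
    simp

theorem smul_add_coe_injective {w₀ : V} (hw₀ : w₀ ∉ Hinf) {c c' : F} {v v' : Hinf}
    (h : c • w₀ + (v : V) = c' • w₀ + (v' : V)) : c = c' ∧ v = v' := by
  have h1 : (c - c') • w₀ + ((v - v' : Hinf) : V) = 0 := by
    rw [sub_smul, Submodule.coe_sub, ← sub_eq_zero.2 h]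
    abel
  have h2 : c - c' = 0 := (smul_add_coe_mem_iff hw₀).1 (h1 ▸ Hinf.zero_mem)
  rw [sub_eq_zero] at h2
  subst h2
  exact ⟨rfl, Subtype.ext (add_left_cancel h)⟩

/-- With `c = 1` this describes the affine points of a line as a coset of a `K`-line; with `c = 0`
it describes the vectors at infinity. -/
theorem smul_add_coe_mem_sup_iff {w₀ : V} (hw₀ : w₀ ∉ Hinf) (e : (Fin 2 → K) ≃ₗ[F] Hinf)
    (p : ℙ K (Fin 2 → K)) (z₀ z : Fin 2 → K) (c : F) :
    c • w₀ + (e z : V) ∈ Submodule.span F {w₀ + (e z₀ : V)} ⊔ spreadElement e p ↔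
      z - c • z₀ ∈ p.submodule := by
  rw [Submodule.mem_sup]
  constructor
  · rintro ⟨y, hy, t, ht, hyt⟩
    obtain ⟨a, rfl⟩ := Submodule.mem_span_singleton.1 hy
    obtain ⟨z', hz', rfl⟩ := mem_spreadElement.1 ht
    have h : a • w₀ + ((e (a • z₀ + z') : Hinf) : V) = c • w₀ + (e z : V) := by
      rw [← hyt, map_add, map_smul, Submodule.coe_add, Submodule.coe_smul, smul_add, add_assoc]
    obtain ⟨rfl, h2⟩ := smul_add_coe_injective hw₀ h
    rw [← e.injective h2, add_sub_cancel_left]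
    exact hz'
  · intro h
    refine ⟨c • (w₀ + (e z₀ : V)), Submodule.smul_mem _ _ (Submodule.mem_span_singleton_self _),
      e (z - c • z₀), coe_mem_spreadElement.2 h, ?_⟩
    rw [map_sub, map_smul, Submodule.coe_sub, Submodule.coe_smul, smul_add]
    abel

theorem exists_eq_smul_add_coe [FiniteDimensional F V]
    (hV : finrank F V = finrank F Hinf + 1) {w₀ : V} (hw₀ : w₀ ∉ Hinf) (x : V) :
    ∃ (c : F) (v : Hinf), x = c • w₀ + (v : V) := by
  have htop : Hinf ⊔ Submodule.span F {w₀} = ⊤ := by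
    apply Submodule.eq_top_of_finrank_eq
    have h1 : Hinf < Hinf ⊔ Submodule.span F {w₀} := by
      refine lt_of_le_of_ne le_sup_left fun h => hw₀ ?_
      rw [h]
      exact Submodule.mem_sup_right (Submodule.mem_span_singleton_self _)
    have h2 := Submodule.finrank_lt_finrank_of_lt h1
    have h3 := Submodule.finrank_le (Hinf ⊔ Submodule.span F {w₀})
    omega
  obtain ⟨v, hv, y, hy, hx⟩ := Submodule.mem_sup.1 (htop ▸ Submodule.mem_top : x ∈ _)
  obtain ⟨c, rfl⟩ := Submodule.mem_span_singleton.1 hy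
  exact ⟨c, ⟨v, hv⟩, by rw [← hx, add_comm]⟩

theorem add_coe_ne_zero {w₀ : V} (hw₀ : w₀ ∉ Hinf) (v : Hinf) : w₀ + (v : V) ≠ 0 := by
  intro h
  have h1 : (1 : F) • w₀ + (v : V) ∈ Hinf := by
    rw [one_smul, h]
    exact Hinf.zero_mem
  exact one_ne_zero ((smul_add_coe_mem_iff hw₀).1 h1)

theorem add_coe_notMem {w₀ : V} (hw₀ : w₀ ∉ Hinf) (v : Hinf) : w₀ + (v : V) ∉ Hinf := by
  rwa [Submodule.add_mem_iff_left _ v.2]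

/-- The affine point spanned by `w₀ + v`. -/
def affinePoint {w₀ : V} (hw₀ : w₀ ∉ Hinf) (v : Hinf) : {x : ℙ F V // ¬ x.submodule ≤ Hinf} :=
  ⟨Projectivization.mk F (w₀ + (v : V)) (add_coe_ne_zero hw₀ v), by
    rw [Projectivization.submodule_mk, Submodule.span_singleton_le_iff_mem]
    exact add_coe_notMem hw₀ v⟩

theorem affinePoint_submodule {w₀ : V} (hw₀ : w₀ ∉ Hinf) (v : Hinf) :
    (affinePoint hw₀ v).1.submodule = Submodule.span F {w₀ + (v : V)} :=
  Projectivization.submodule_mk _ _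

theorem affinePoint_injective {w₀ : V} (hw₀ : w₀ ∉ Hinf) :
    Function.Injective (affinePoint hw₀) := by
  intro v v' h
  have h1 := congrArg Subtype.val h
  obtain ⟨c, hc⟩ := (Projectivization.mk_eq_mk_iff' F _ _ _ _).1 h1
  have h2 : c • w₀ + ((c • v' : Hinf) : V) = (1 : F) • w₀ + (v : V) := by
    rw [one_smul, ← hc, smul_add, Submodule.coe_smul]
  obtain ⟨rfl, h3⟩ := smul_add_coe_injective hw₀ h2
  rw [← h3, one_smul]

theorem affinePoint_surjective [FiniteDimensional F V]
    (hV : finrank F V = finrank F Hinf + 1) {w₀ : V} (hw₀ : w₀ ∉ Hinf) :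
    Function.Surjective (affinePoint hw₀) := by
  rintro ⟨x, hx⟩
  rw [le_iff_rep_mem] at hx
  obtain ⟨c, v, hcv⟩ := exists_eq_smul_add_coe hV hw₀ x.rep
  have hc : c ≠ 0 := by
    rintro rfl
    rw [hcv] at hx
    exact hx (by simp)
  refine ⟨c⁻¹ • v, Subtype.ext (Projectivization.submodule_injective ?_)⟩
  rw [affinePoint_submodule, Projectivization.submodule_eq, hcv,
    ← Submodule.span_singleton_smul_eq hc.isUnit, smul_add, Submodule.coe_smul,
    smul_inv_smul₀ hc]

theorem submodule_le_submodule_iff {p p' : ℙ K (Fin 2 → K)} :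
    p.submodule ≤ p'.submodule ↔ p = p' := by
  refine ⟨fun h => Projectivization.submodule_injective ?_, fun h => h ▸ le_rfl⟩
  exact Submodule.eq_of_le_of_finrank_eq h (by simp [Projectivization.finrank_submodule])

theorem isAffineChart_ABB [FiniteDimensional F V] (hV : finrank F V = finrank F Hinf + 1)
    {S : Set (Submodule F V)} (e : (Fin 2 → K) ≃ₗ[F] Hinf)
    (hS : ∀ T, T ∈ S ↔ ∃ p, T = spreadElement e p) {w₀ : V} (hw₀ : w₀ ∉ Hinf) :
    IsAffineChart (K := K) (ABBLines Hinf S) (Set.range Sum.inr)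
      (fun z => Sum.inl (affinePoint hw₀ (e z)))
      (fun p => Sum.inr ⟨spreadElement e p, (hS _).2 ⟨p, rfl⟩⟩) where
  pt_injective z z' h := e.injective (affinePoint_injective hw₀ (Sum.inl_injective h))
  pt_notMem z := by simp
  exists_pt := by
    rintro (x | T) h
    · obtain ⟨v, rfl⟩ := affinePoint_surjective hV hw₀ x
      exact ⟨e.symm v, by simp⟩
    · exact absurd ⟨T, rfl⟩ h
  dir_mem p := ⟨_, rfl⟩
  exists_dir := by
    rintro _ ⟨⟨T, hT⟩, rfl⟩
    obtain ⟨p, rfl⟩ := (hS T).1 hT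
    exact ⟨p, rfl⟩
  exists_line z p := by
    refine ⟨_, ⟨(affinePoint hw₀ (e z)).1.submodule ⊔ spreadElement e p, Or.inr
      ⟨_, (affinePoint hw₀ (e z)).2, _, (hS _).2 ⟨p, rfl⟩, rfl⟩, rfl⟩, ?_, ?_⟩
    · exact le_sup_left (a := (affinePoint hw₀ (e z)).1.submodule)
    · exact le_sup_right (b := spreadElement e p)
  pt_mem_iff := by
    have hpt : ∀ (z : Fin 2 → K) (M : Submodule F V),
        (affinePoint hw₀ (e z)).1.submodule ≤ M ↔ (1 : F) • w₀ + (e z : V) ∈ M := by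
      intro z M
      rw [affinePoint_submodule, Submodule.span_singleton_le_iff_mem, one_smul]
    rintro m ⟨M, hM, rfl⟩ z p hz hp z'
    replace hz : (affinePoint hw₀ (e z)).1.submodule ≤ M := hz
    replace hp : spreadElement e p ≤ M := hp
    change (affinePoint hw₀ (e z')).1.submodule ≤ M ↔ _
    rcases hM with rfl | ⟨x, hx, T, hT, rfl⟩
    · exact absurd hz (affinePoint hw₀ (e z)).2
    · obtain ⟨v, hv⟩ := affinePoint_surjective hV hw₀ ⟨x, hx⟩
      obtain ⟨z₀, rfl⟩ := e.surjective v
      obtain rfl : (affinePoint hw₀ (e z₀)).1 = x := congrArg Subtype.val hv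
      obtain ⟨p', rfl⟩ := (hS T).1 hT
      rw [hpt, affinePoint_submodule, smul_add_coe_mem_sup_iff hw₀, one_smul] at hz ⊢
      rw [affinePoint_submodule] at hp
      -- The part at infinity of a line is a single spread element.
      have hpp : p = p' := by
        rw [← submodule_le_submodule_iff]
        intro y hy
        have := hp (coe_mem_spreadElement.2 hy)
        have h0 : (0 : F) • w₀ + (e y : V) = e y := by simp
        rwa [← h0, smul_add_coe_mem_sup_iff hw₀, zero_smul, sub_zero] at this
      subst hpp
      rw [← Submodule.sub_mem_iff_left _ hz, sub_sub_sub_cancel_right]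

/-- The directions determined by the points `⟨w₀ + e (t, t ^ 2 ^ i)⟩`. -/
theorem mem_directions_iff [CharP K 2] {Q : Set (ℙ F V)} {w₀ : V} (hw₀ : w₀ ∉ Hinf)
    (e : (K × K) ≃ₗ[F] Hinf) (i : ℕ)
    (hQ : ∀ x, x ∈ Q ↔ ∃ t : K, x.submodule = Submodule.span F {w₀ + (e (t, t ^ 2 ^ i) : V)})
    (d : ℙ F Hinf) :
    d ∈ directions Hinf Q ↔
      ∃ u : K, u ≠ 0 ∧ d.submodule = Submodule.span F {e (u, u ^ 2 ^ i)} := by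
  constructor
  · rintro ⟨x, hx, y, hy, hxy, hd⟩
    obtain ⟨t, ht⟩ := (hQ x).1 hx
    obtain ⟨t', ht'⟩ := (hQ y).1 hy
    have htt : t - t' ≠ 0 := by
      intro h
      rw [sub_eq_zero.1 h, ← ht'] at ht
      exact hxy (Projectivization.submodule_injective ht)
    refine ⟨t - t', htt, ?_⟩
    have hrep : (d.rep : V) ∈ x.submodule ⊔ y.submodule := by
      refine hd ⟨d.rep, ?_, rfl⟩
      rw [SetLike.mem_coe, ← le_iff_rep_mem]
    rw [ht, ht', ← Submodule.span_union, Set.singleton_union, Submodule.mem_span_pair] at hrep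
    obtain ⟨a, b, hab⟩ := hrep
    -- A vector at infinity has `w₀`-coefficient zero, so it is a multiple of the difference of the
    -- two affine vectors.
    have h1 : (a + b) • w₀ + ((a • e (t, t ^ 2 ^ i) + b • e (t', t' ^ 2 ^ i) : Hinf) : V) =
        (0 : F) • w₀ + (d.rep : V) := by
      rw [zero_smul, zero_add, ← hab, add_smul, smul_add, smul_add]
      push_cast
      abel
    obtain ⟨h2, h3⟩ := smul_add_coe_injective hw₀ h1
    have hb : b = -a := by rw [eq_neg_iff_add_eq_zero, add_comm, h2]
    have h4 : d.rep = a • e (t - t', (t - t') ^ 2 ^ i) := by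
      rw [← h3, hb, sub_pow_char_pow, ← Prod.mk_sub_mk, map_sub, neg_smul, smul_sub,
        sub_eq_add_neg]
    have ha : a ≠ 0 := by
      rintro rfl
      exact d.rep_nonzero (by rw [h4, zero_smul])
    rw [Projectivization.submodule_eq, h4, Submodule.span_singleton_smul_eq ha.isUnit]
  · rintro ⟨u, hu, hd⟩
    have hQ' : ∀ t : K, (affinePoint hw₀ (e (t, t ^ 2 ^ i))).1 ∈ Q := fun t =>
      (hQ _).2 ⟨t, affinePoint_submodule hw₀ _⟩
    refine ⟨_, hQ' u, _, hQ' 0, ?_, ?_⟩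
    · intro h
      have := e.injective (affinePoint_injective hw₀ (Subtype.ext h))
      exact hu (congrArg Prod.fst this)
    · rw [hd, Submodule.map_span_le, affinePoint_submodule, affinePoint_submodule]
      rintro _ rfl
      have : Hinf.subtype (e (u, u ^ 2 ^ i)) = (w₀ + (e (u, u ^ 2 ^ i) : V)) -
          (w₀ + (e (0, 0 ^ 2 ^ i) : V)) := by
        rw [zero_pow (by positivity)]
        simp [← Prod.zero_eq_mk]
      rw [this]
      exact Submodule.sub_mem _ (Submodule.mem_sup_left (Submodule.mem_span_singleton_self _))
        (Submodule.mem_sup_right (Submodule.mem_span_singleton_self _))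

theorem exists_coordinates [FiniteDimensional F V] [FiniteDimensional F K]
    (hV : finrank F V = finrank F Hinf + 1)
    {w₀ : V} (hw₀ : w₀ ∉ Hinf) (e : (K × K) ≃ₗ[F] Hinf) :
    ∃ G : (F × K × K) ≃ₗ[F] V, ∀ c y, G (c, y) = c • w₀ + (e y : V) := by
  let G₀ : (F × K × K) →ₗ[F] V := (LinearMap.toSpanSingleton F V w₀).coprod
    (Hinf.subtype ∘ₗ e.toLinearMap)
  have hG : ∀ c y, G₀ (c, y) = c • w₀ + (e y : V) := fun c y => by simp [G₀]
  have hinj : Function.Injective G₀ := by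
    rintro ⟨c, y⟩ ⟨c', y'⟩ h
    rw [hG, hG] at h
    obtain ⟨rfl, h2⟩ := smul_add_coe_injective hw₀ h
    rw [e.injective h2]
  exact ⟨LinearEquiv.ofInjectiveOfFinrankEq G₀ hinj (by
    rw [hV, finrank_prod, finrank_self, e.finrank_eq, add_comm]), hG⟩

end BruckBose

/-! ### Assembly of the three statements -/

theorem mainTheorem9 (h k : ℕ) (hh : 2 ≤ h) (hk : 2 ≤ k)
    -- the fields with `q = 2 ^ h` and `q ^ k` elements, and the subfield of order two
    {F K : Type*} [Field F] [Field K] [Algebra F K]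
    (hF : Nat.card F = 2 ^ h) (hK : Module.finrank F K = k)
    (F₂ : Subfield F) (hF₂ : Nat.card F₂ = 2)
    -- `PG(2k, q)`, its hyperplane at infinity and a Desarguesian spread
    {V : Type*} [AddCommGroup V] [Module F V] (hV : Module.finrank F V = 2 * k + 1)
    (Hinf : Submodule F V) (hHinf : Module.finrank F Hinf = 2 * k)
    (S : Set (Submodule F V)) (hS : IsDesarguesianSpread K Hinf S)
    -- a translation hyperoval `H` in `PG(2, q ^ k)` with translation line `l`
    (l H : Set (ℙ K (Fin 3 → K)))
    (hH : IsTranslationHyperoval (projLines K (Fin 3 → K)) (Nat.card K) l H)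
    -- an identification of `PG(2, q ^ k)` with the André/Bruck-Bose plane, `l` being at infinity
    (φ : ℙ K (Fin 3 → K) ≃ ABBPoint Hinf S)
    (hφ : IsPlaneIso (projLines K (Fin 3 → K)) (ABBLines Hinf S) φ)
    (hφl : φ '' l = Set.range Sum.inr) :
    (ABBAffinePart (φ '' H)).ncard = (2 ^ h) ^ k ∧
    IsPseudoregulusType F₂ k h (directions Hinf (ABBAffinePart (φ '' H))) ∧
    ∃ i : ℕ, Nat.gcd i (h * k) = 1 ∧ ∃ g : V ≃ₗ[F] F × K × K,
      Hinf.map g.toLinearMap = LinearMap.ker (LinearMap.fst F F (K × K)) ∧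
      (∀ T : Submodule F V, T ∈ S ↔ ∃ a b : K, (a, b) ≠ (0, 0) ∧
        (T.map g.toLinearMap : Set (F × K × K)) = {w | ∃ c : K, w = (0, c * a, c * b)}) ∧
      (∀ x : ℙ F V, x ∈ ABBAffinePart (φ '' H) ↔ ∃ t : K,
        x.submodule.map g.toLinearMap = Submodule.span F {((1 : F), t, t ^ 2 ^ i)}) ∧
      (∀ d : ℙ F Hinf, d ∈ directions Hinf (ABBAffinePart (φ '' H)) ↔ ∃ u : K, u ≠ 0 ∧
        (d.submodule.map Hinf.subtype).map g.toLinearMap =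
          Submodule.span F {((0 : F), u, u ^ 2 ^ i)}) := by

  obtain ⟨e, he⟩ := hS
  have hS' : ∀ T, T ∈ S ↔ ∃ p, T = spreadElement e p := fun T => by rw [he]; rfl
  have : Finite F := Nat.finite_of_card_ne_zero (by rw [hF]; positivity)
  have : FiniteDimensional F K := Module.finite_of_finrank_pos (by omega)
  have : FiniteDimensional F V := Module.finite_of_finrank_pos (by omega)
  have hKc : Nat.card K = 2 ^ (h * k) := by
    rw [Module.natCard_eq_pow_finrank (K := F), hF, hK, pow_mul]
  have : Finite K := Nat.finite_of_card_ne_zero (by rw [hKc]; positivity)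
  have := charP_two_of_natCard hKc
  have hVH : Module.finrank F V = Module.finrank F Hinf + 1 := by omega
  have hH' := hφ.isTranslationHyperoval_image hH
  rw [hφl] at hH'
  set A := φ '' H
  obtain ⟨x₀, hx₀⟩ : ∃ x₀ : {x : ℙ F V // ¬ x.submodule ≤ Hinf},
      (Sum.inl x₀ : ABBPoint Hinf S) ∈ A := by
    have hlt : (A ∩ Set.range Sum.inr).ncard < A.ncard := by
      rw [hH'.2.2.1, hH'.1.2]
      have : 0 < Nat.card K := Nat.card_pos
      omega
    by_contra! hcon
    rw [Set.inter_eq_left.2] at hlt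
    · exact lt_irrefl _ hlt
    · rintro (x | T) hx
      · exact absurd hx (hcon x)
      · exact ⟨T, rfl⟩
  -- The origin of the chart is placed at a point of the hyperoval, as `exists_graph_pow` requires.
  obtain ⟨w₀, hw₀, hxw⟩ : ∃ (w₀ : V) (hw₀ : w₀ ∉ Hinf), affinePoint hw₀ (e 0) = x₀ := by
    have hw := x₀.2
    rw [le_iff_rep_mem] at hw
    refine ⟨_, hw, Subtype.ext (Projectivization.submodule_injective ?_)⟩
    rw [affinePoint_submodule, Projectivization.submodule_eq x₀.1, map_zero, Submodule.coe_zero,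
      add_zero]
  have hchart := isAffineChart_ABB hVH e hS' hw₀
  obtain ⟨i, hi, ε, hε⟩ := hchart.exists_graph_pow (by simp)
    (Nat.mul_ne_zero (by omega) (by omega)) hKc hH' (by rw [hxw]; exact hx₀)
  let e' : (K × K) ≃ₗ[F] Hinf := (ε.restrictScalars F).trans e
  have he' : ∀ y, e' y = e (ε y) := fun y => rfl
  have hQ : ∀ x, x ∈ ABBAffinePart A ↔
      ∃ t : K, x.submodule = Submodule.span F {w₀ + (e' (t, t ^ 2 ^ i) : V)} := by
    intro x
    constructor
    · rintro ⟨hx, hxA⟩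
      obtain ⟨v, hv⟩ := affinePoint_surjective hVH hw₀ ⟨x, hx⟩
      obtain ⟨z, rfl⟩ := e.surjective v
      rw [← hv, hε] at hxA
      obtain ⟨t, rfl⟩ := hxA
      exact ⟨t, by rw [he', ← affinePoint_submodule hw₀, hv]⟩
    · rintro ⟨t, ht⟩
      rw [← affinePoint_submodule hw₀] at ht
      obtain rfl := Projectivization.submodule_injective ht
      exact ⟨(affinePoint hw₀ _).2, (hε _).2 ⟨t, rfl⟩⟩
  have hD := mem_directions_iff hw₀ e' i hQ
  refine ⟨?_, isPseudoregulusType_of_eq_frobeniusGraph hh hk hF hK hi F₂ hF₂ e' _ hD, i, hi, ?_⟩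
  · have hrange : ABBAffinePart A =
        Set.range fun t : K => (affinePoint hw₀ (e' (t, t ^ 2 ^ i))).1 := by
      ext x
      rw [hQ]
      refine exists_congr fun t => ?_
      rw [← affinePoint_submodule hw₀, eq_comm, Projectivization.submodule_injective.eq_iff]
    rw [hrange, Set.ncard_range_of_injective, hKc, pow_mul]
    intro t t' htt
    exact congrArg Prod.fst (e'.injective (affinePoint_injective hw₀ (Subtype.ext htt)))
  obtain ⟨G, hG⟩ := exists_coordinates hVH hw₀ e'
  have hsymm : ∀ (M : Submodule F V) (N : Submodule F (F × K × K)), M.map G.symm.toLinearMap = N ↔ M = N.map G.toLinearMap := by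
    intro M N
    rw [eq_comm (a := M)]
    exact Submodule.map_symm_eq_iff G
  have hmem : ∀ (M : Submodule F V) w, w ∈ M.map G.symm.toLinearMap ↔ G w ∈ M := by
    intro M w
    exact Submodule.mem_map_equiv (e := G.symm) M
  have hspan : ∀ w, (Submodule.span F {w}).map G.toLinearMap = Submodule.span F {G w} := by
    intro w
    rw [Submodule.map_span, Set.image_singleton]
    rfl
  refine ⟨G.symm, ?_, fun T => ?_, fun x => ?_, fun d => ?_⟩
  · ext ⟨c, y⟩
    rw [hmem, hG, smul_add_coe_mem_iff hw₀]
    rfl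
  -- The change of basis `ε` is `K`-linear, so the spread elements are still the `K`-lines in the
  -- new coordinates.
  · have hT : ∀ (p : ℙ K (Fin 2 → K)) (a b : K), p.submodule = Submodule.span K {ε (a, b)} →
        ((spreadElement e p).map G.symm.toLinearMap : Set (F × K × K)) =
          {w | ∃ c : K, w = (0, c * a, c * b)} := by
      rintro p a b hp
      ext ⟨s, y⟩
      rw [SetLike.mem_coe, hmem, hG, mem_spreadElement, hp]
      constructor
      · rintro ⟨_, hz, hzy⟩
        obtain ⟨c, rfl⟩ := Submodule.mem_span_singleton.1 hz
        have hzy' : (0 : F) • w₀ + (e (c • ε (a, b)) : V) = s • w₀ + (e' y : V) := by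
          rw [zero_smul, zero_add, hzy]
        obtain ⟨rfl, h2⟩ := smul_add_coe_injective hw₀ hzy'
        rw [he', ← map_smul] at h2
        have h3 := ε.injective (e.injective h2)
        exact ⟨c, by rw [← h3]; rfl⟩
      · rintro ⟨c, hc⟩
        rw [Prod.mk.injEq] at hc
        obtain ⟨rfl, rfl⟩ := hc
        refine ⟨ε (c * a, c * b), Submodule.mem_span_singleton.2 ⟨c, ?_⟩, ?_⟩
        · rw [← map_smul]; rfl
        · rw [zero_smul, zero_add, he']
    rw [hS']
    constructor
    · rintro ⟨p, rfl⟩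
      refine ⟨(ε.symm p.rep).1, (ε.symm p.rep).2, ?_, hT p _ _ ?_⟩
      · intro h0
        have : ε.symm p.rep = 0 := h0
        exact p.rep_nonzero (by simpa using this)
      · rw [Prod.mk.eta, LinearEquiv.apply_symm_apply, Projectivization.submodule_eq]
    · rintro ⟨a, b, hab, hTab⟩
      have hne : ε (a, b) ≠ 0 := by simpa [Prod.mk_eq_zero] using hab
      refine ⟨Projectivization.mk K _ hne, ?_⟩
      rw [← hT _ a b (Projectivization.submodule_mk _ hne), SetLike.coe_set_eq] at hTab
      exact Submodule.map_injective_of_injective G.symm.injective hTab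
  · rw [hQ]
    refine exists_congr fun t => ?_
    rw [hsymm, hspan, hG, one_smul]
  · rw [hD]
    refine exists_congr fun u => and_congr_right fun _ => ?_
    have hu : Submodule.span F {G (0, u, u ^ 2 ^ i)} =
        (Submodule.span F {e' (u, u ^ 2 ^ i)}).map Hinf.subtype := by
      rw [Submodule.map_span, Set.image_singleton, hG, zero_smul, zero_add]
      rfl
    rw [hsymm, hspan, hu,
      (Submodule.map_injective_of_injective Hinf.subtype_injective).eq_iff]
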